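/- **Theorem 1.** *Plant.* Let $n\ge 1$ and consider $M(q)\ddot q+C(q,\dot q)\dot q+G(q)=\tau+d(t)$, $q\in\mathbb R^n$, where $M$ is $C^1$, $C$ and $G$ are locally Lipschitz, $M(q)$ is symmetric with $\mu_1 I\preceq M(q)\preceq\mu_2 I$ ($\mu_1,\mu_2>0$), $z^T(\dot M-2C)z=0$ for all $z$, and $d$ is bounded and piecewise continuous (continuous on some $[t,t+\delta)$ for every $t\ge0$; solutions are continuous and satisfy the equations with right derivatives). *Reference and constraints.* Let $\underline k_i(t)<\bar k_i(t)$ be joint limits, $X_q(t)=\{q:\underline k_i(t)<q_i<\bar k_i(t)\ \forall i\}$, $q_d$ a $C^2$ desired trajectory with $q_d,\dot q_d$ bounded on $t\ge 0$, and $k_c(t)=\min_i\min\{\bar k_i-q_{d,i},\,q_{d,i}-\underline k_i\}$. Assume that $k_c$ is $C^2$ and, for $t\ge0$, bounded and bounded away from $0$, with $|\dot k_c/k_c|\le\ell$. Let $T_c>0$, $\gamma(t)=1-((T_c-t)/T_c)^3$ for $t<T_c$ and $\gamma(t)=1$ for $t\ge T_c$. *Controller.* Put $Z_1=q-q_d$,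 $Z_1^\gamma=\gamma Z_1$, $Z_2=\dot q-\alpha$, $Z=(Z_1,Z_2)$, $Z_a=(q,\dot q,Z_1,Z_2)$, $$\alpha=-K_1Z_1-\frac{a\dot\gamma^2\|Z_1\|^2}{\beta(k_c^2-\|Z_1^\gamma\|^2)}Z_1+\dot q_d+\frac{\dot k_c}{k_c}Z_1,\qquad \tau=\hat W_a^TS_a(Z_a)-K_2Z_2-\frac{\gamma Z_1^\gamma}{\beta(k_c^2-\|Z_1^\gamma\|^2)},$$ where $S_a$ ($l_a$ neurons) and $S_c$ ($l_c$ neurons) are vectors of Gaussian radial basis functions, $\hat W_a\in\mathbb R^{l_a\times n}$, $\hat W_c\in\mathbb R^{l_c}$. With $\hat J=\hat W_c^TS_c(Z)$, $r=Z^TQZ+\tau^TR\tau$ ($Q,R\succeq0$) and $\Lambda=-\tfrac1\psi S_c+\nabla S_c\dot Z$, the weights obey $$\dot{\hat W}_c=-\sigma_c(r+\hat W_c^T\Lambda)\Lambda-\sigma_c\eta_c\hat W_c,$$ $$\dot{\hat W}_{a,i}=-\sigma_a\Big(\hat W_{a,i}^TS_a+\tfrac{Z_{2,i}}{\sigma_a}+k_a\hat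 J\Big)S_a-\sigma_a\eta_a\hat W_{a,i}\quad(i=1,\dots,n).$$ The parameters satisfy $\beta,a,\sigma_a,\sigma_c,\eta_a,\eta_c,k_a,\psi>0$, $K_1>1$, $z^T(K_2-\tfrac12I)z\ge\kappa\|z\|^2$ for all $z$ with $\kappa>0$, and $\eta_c>2n\sigma_ak_a^2\bar S_c$, where $\|S_a\|^2\le\bar S_a$ and $\|S_c\|^2\le\bar S_c$. *Networks.* Let $f=C\alpha+G+M\dot\alpha-d$. For fixed ideal weights $W_a^*,W_c^*$ and constants $\bar\varepsilon_a,\bar e_c$ say that the networks approximate on a set $D$ of pairs (time, state), the state being $x=(q,\dot q,\hat W_a,\hat W_c)$, if on $D$: $\|f-W_a^{*T}S_a(Z_a)\|\le\bar\varepsilon_a$ and $|r+W_c^{*T}\Lambda|\le\bar e_c$. Put $$\iota_1=\min\{K_1,\ 2\kappa/\mu_2,\ \sigma_c(\eta_c-2n\sigma_ak_a^2\bar S_c),\ \sigma_a\eta_a\},$$ $$\iota_2=\tfrac12(\eta_c+2n\sigma_ak_a^2\bar S_c)\|W_c^*\|^2+\tfrac{\sigma_a}2(\eta_a+\bar S_a)\|W_a^*\|_F^2+\tfrac14\bar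 e_c^2+\tfrac12\bar\varepsilon_a^2+\tfrac1{4a},$$ $$V=\frac1{2\beta}\ln\frac{k_c^2}{k_c^2-\|Z_1^\gamma\|^2}+\tfrac12Z_2^TMZ_2+\tfrac1{2\sigma_c}\|\hat W_c-W_c^*\|^2+\tfrac12\|\hat W_a-W_a^*\|_F^2,$$ and for real $v,z$ let $\Omega_{v,z}$ be the set of $(t,x)$ with $t\ge0$, $\|Z_1^\gamma\|<k_c$, $V\le v$ and, if $t\le T_c$, $\|Z_1\|\le e^{\ell t}\big(z+t\sqrt{2v/\mu_1}\big)$. (Every bounded set of initial states, including states that violate the constraints, is contained in the slice $t=0$ of some $\Omega_{v,z}$.) *Conclusion.* $\iota_1,\iota_2>0$, and there is a constant $B$ (an ultimate bound, independent of the size of the initial state) such that the following two statements hold. 1. For every $\varrho$ there are $B_\varrho,\mathcal T_\varrho$ and a function $\epsilon\mapsto\mathcal T'_\varrho(\epsilon)$ such that for every $D$ on which the networks approximate, every closed-loop solution on an interval $[0,T)$ with $\|x(0)\|\le\varrho$ that stays in $D$ satisfies for all $t\in[0,T)$: (a) all closed-loop signals ($q,\dot q,\ddot q,Z_1,Z_2,\alpha,\dot\alpha,\tau,\hat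 W_a,\hat W_c,\hat J,r,\Lambda$ and $r+\hat W_c^T\Lambda$) are bounded by $B_\varrho$, and by $B$ if $t\ge\mathcal T_\varrho$; (b) $\|Z_1^\gamma(t)\|<k_c(t)$; (c) if $t\ge T_c$, then $\|Z_1(t)\|<k_c(t)$ and $q(t)\in X_q(t)$; (d) for every $\epsilon>0$, if $t\ge\mathcal T'_\varrho(\epsilon)$, then $\|Z_1(t)\|\le k_c(t)\sqrt{1-e^{-2\beta\iota_2/\iota_1}}+\epsilon$. 2. (Semi-global statement.) For all $v>\iota_2/\iota_1$ and all $z$ such that the networks approximate on $\Omega_{v,z}$ and for every initial state $x_0$ with $(0,x_0)\in\Omega_{v,z}$, the closed loop has a solution on $[0,\infty)$ with $x(0)=x_0$; every solution on an interval $[0,T)$ with this initial state coincides with it there; it stays in $\Omega_{v,z}$; and it satisfies (a)–(d) for all $t\ge0$, with the same $B$ and with constants that depend on $v,z$ in place of $\varrho$ but not on $x_0$. -/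

import Mathlib

open scoped RealInnerProductSpace

/-- Euclidean space `ℝᵐ`. -/
abbrev Vec (m : ℕ) := EuclideanSpace ℝ (Fin m)

/-- `k` stacked blocks from `ℝⁿ`, with the Euclidean norm of `ℝ^(k n)`. -/
abbrev Stack (k n : ℕ) := PiLp 2 (fun _ : Fin k => Vec n)

/-- Closed-loop state `(q, q̇, Ŵₐ, Ŵ_c)`; the actor weight matrix is given by its columns, one
column (weight vector) per joint. -/
abbrev State (n la lc : ℕ) := Vec n × Vec n × (Fin n → Vec la) × Vec lc

/-- Gaussian radial basis functions with given centres and common width: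
`h_j(z) = exp (-‖z - c_j‖² / w²)`. -/
noncomputable def rbf {P : Type*} [NormedAddCommGroup P] {k : ℕ} (c : Fin k → P) (w : ℝ) (z : P) :
    Vec k :=
  WithLp.toLp 2 (fun j => Real.exp (-(‖z - c j‖ ^ 2 / w ^ 2)))

/-- The prescribed-time shifting function `γ`. -/
noncomputable def shift (Tc t : ℝ) : ℝ :=
  if t < Tc then 1 - ((Tc - t) / Tc) ^ 3 else 1

/-- The derivative `γ̇` of the shifting function. -/
noncomputable def shiftRate (Tc t : ℝ) : ℝ :=
  if t < Tc then 3 * (Tc - t) ^ 2 / Tc ^ 3 else 0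

/-- The data of the control problem: manipulator, reference, joint limits, controller parameters
and the two radial basis function networks (`la` actor neurons, `lc` critic neurons). -/
structure ArmControl (n la lc : ℕ) where
  /-- inertia matrix `M(q)` -/
  M : Vec n → Vec n →L[ℝ] Vec n
  /-- Coriolis and centrifugal matrix `C(q, q̇)` -/
  C : Vec n → Vec n → Vec n →L[ℝ] Vec n
  /-- gravity `G(q)` -/
  G : Vec n → Vec n
  /-- disturbance `d(t)` -/
  d : ℝ → Vec n
  /-- desired trajectory -/
  qd : ℝ → Vec n
  /-- lower joint limits -/
  kLow : Fin n → ℝ → ℝ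
  /-- upper joint limits -/
  kUp : Fin n → ℝ → ℝ
  /-- prescribed time from which the joint limits are imposed -/
  Tc : ℝ
  β : ℝ
  a : ℝ
  K₁ : ℝ
  K₂ : Vec n →L[ℝ] Vec n
  /-- actor learning rate -/
  σa : ℝ
  /-- critic learning rate -/
  σc : ℝ
  /-- actor damping -/
  ηa : ℝ
  /-- critic damping -/
  ηc : ℝ
  /-- gain of the critic signal in the actor law -/
  ka : ℝ
  /-- time constant in the temporal-difference error -/
  ψ : ℝ
  /-- error weight in the instantaneous cost -/
  Q : Stack 2 n →L[ℝ] Stack 2 n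
  /-- input weight in the instantaneous cost -/
  R : Vec n →L[ℝ] Vec n
  actorCenter : Fin la → Stack 4 n
  actorWidth : ℝ
  criticCenter : Fin lc → Stack 2 n
  criticWidth : ℝ

namespace ArmControl

variable {n la lc : ℕ} (S : ArmControl n la lc)

/-- The admissible set `X_q(t)` of joint positions. -/
def admissible (t : ℝ) : Set (Vec n) := {q | ∀ i, S.kLow i t < q i ∧ q i < S.kUp i t}

/-- The error bound `k_c(t)`: distance of the desired trajectory to the joint limits. -/
noncomputable def kc (t : ℝ) : ℝ := ⨅ i, min (S.kUp i t - S.qd t i) (S.qd t i - S.kLow i t)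

/-- Tracking error `Z₁ = q - q_d`. -/
def Z₁ (t : ℝ) (q : Vec n) : Vec n := q - S.qd t

/-- Transformed tracking error `γ Z₁`. -/
noncomputable def Zγ (t : ℝ) (q : Vec n) : Vec n := shift S.Tc t • S.Z₁ t q

/-- Distance to the barrier, `k_c² - ‖γ Z₁‖²`. -/
noncomputable def gap (t : ℝ) (q : Vec n) : ℝ := S.kc t ^ 2 - ‖S.Zγ t q‖ ^ 2

/-- Virtual control `α`. -/
noncomputable def α (t : ℝ) (q : Vec n) : Vec n :=
  -(S.K₁ • S.Z₁ t q)
    - (S.a * shiftRate S.Tc t ^ 2 * ‖S.Z₁ t q‖ ^ 2 / (S.β * S.gap t q)) • S.Z₁ t q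
    + deriv S.qd t + (deriv S.kc t / S.kc t) • S.Z₁ t q

/-- Time derivative `α̇` of the virtual control when the joints pass through `q` at time `t` with
velocity `v`. -/
noncomputable def αDot (t : ℝ) (q v : Vec n) : Vec n :=
  deriv (fun s => S.α s (q + (s - t) • v)) t

/-- `Z₂ = q̇ - α`. -/
noncomputable def Z₂ (t : ℝ) (q v : Vec n) : Vec n := v - S.α t q

/-- Critic input `Z = (Z₁, Z₂)`. -/
noncomputable def Zc (t : ℝ) (q v : Vec n) : Stack 2 n :=
  WithLp.toLp 2 ![S.Z₁ t q, S.Z₂ t q v]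

/-- Actor input `Zₐ = (q, q̇, Z₁, Z₂)`. -/
noncomputable def Za (t : ℝ) (q v : Vec n) : Stack 4 n :=
  WithLp.toLp 2 ![q, v, S.Z₁ t q, S.Z₂ t q v]

/-- Actor basis functions. -/
noncomputable def Sa : Stack 4 n → Vec la := rbf S.actorCenter S.actorWidth

/-- Critic basis functions. -/
noncomputable def Sc : Stack 2 n → Vec lc := rbf S.criticCenter S.criticWidth

/-- Output `Wᵀ Sₐ(Zₐ)` of the actor network with weights `W`. -/
noncomputable def actorOut (t : ℝ) (q v : Vec n) (W : Fin n → Vec la) : Vec n :=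
  WithLp.toLp 2 (fun i => ⟪W i, S.Sa (S.Za t q v)⟫)

/-- Control law `τ`. -/
noncomputable def τ (t : ℝ) (x : State n la lc) : Vec n :=
  S.actorOut t x.1 x.2.1 x.2.2.1 - S.K₂ (S.Z₂ t x.1 x.2.1)
    - (shift S.Tc t / (S.β * S.gap t x.1)) • S.Zγ t x.1

/-- Joint acceleration: the solution `q̈` of `M(q) q̈ + C(q, q̇) q̇ + G(q) = τ + d`. -/
noncomputable def accel (t : ℝ) (x : State n la lc) : Vec n :=
  (S.M x.1).inverse (S.τ t x + S.d t - S.C x.1 x.2.1 x.2.1 - S.G x.1)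

/-- Estimated cost-to-go `Ĵ = Ŵ_cᵀ S_c(Z)`. -/
noncomputable def Jhat (t : ℝ) (x : State n la lc) : ℝ :=
  ⟪x.2.2.2, S.Sc (S.Zc t x.1 x.2.1)⟫

/-- Instantaneous cost `r = Zᵀ Q Z + τᵀ R τ`. -/
noncomputable def cost (t : ℝ) (x : State n la lc) : ℝ :=
  ⟪S.Zc t x.1 x.2.1, S.Q (S.Zc t x.1 x.2.1)⟫ + ⟪S.τ t x, S.R (S.τ t x)⟫

/-- `Ż = (Ż₁, Ż₂)` along the closed loop. -/
noncomputable def ZcDot (t : ℝ) (x : State n la lc) : Stack 2 n :=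
  WithLp.toLp 2 ![x.2.1 - deriv S.qd t, S.accel t x - S.αDot t x.1 x.2.1]

/-- The critic regressor `Λ = -S_c / ψ + ∇S_c Ż`. -/
noncomputable def Λ (t : ℝ) (x : State n la lc) : Vec lc :=
  -((1 / S.ψ) • S.Sc (S.Zc t x.1 x.2.1)) + fderiv ℝ S.Sc (S.Zc t x.1 x.2.1) (S.ZcDot t x)

/-- Temporal-difference error `r + Wᵀ Λ` for critic weights `W`. -/
noncomputable def tdError (t : ℝ) (x : State n la lc) (W : Vec lc) : ℝ :=
  S.cost t x + ⟪W, S.Λ t x⟫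

/-- Actor weight update law. -/
noncomputable def actorRate (t : ℝ) (x : State n la lc) : Fin n → Vec la := fun i =>
  -((S.σa * (S.actorOut t x.1 x.2.1 x.2.2.1 i + S.Z₂ t x.1 x.2.1 i / S.σa + S.ka * S.Jhat t x))
      • S.Sa (S.Za t x.1 x.2.1))
    - (S.σa * S.ηa) • x.2.2.1 i

/-- Critic weight update law. -/
noncomputable def criticRate (t : ℝ) (x : State n la lc) : Vec lc :=
  -((S.σc * S.tdError t x x.2.2.2) • S.Λ t x) - (S.σc * S.ηc) • x.2.2.2

/-- Right-hand side of the closed-loop system. -/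
noncomputable def field (t : ℝ) (x : State n la lc) : State n la lc :=
  (x.2.1, S.accel t x, S.actorRate t x, S.criticRate t x)

/-- `x` solves the closed-loop system on the interval `I` (of the form `[0, T)` or `[0, ∞)`):
`x` is continuous and its right derivative is the right-hand side. The derivative is one-sided
because the disturbance may jump; at times where it is continuous, the derivative is two-sided. -/
def IsSolutionOn (I : Set ℝ) (x : ℝ → State n la lc) : Prop :=
  ContinuousOn x I ∧ ∀ t ∈ I, HasDerivWithinAt x (S.field t (x t)) (Set.Ici t) t

/-- The unknown dynamics `f = C α + G + M α̇ - d`. -/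
noncomputable def f (t : ℝ) (x : State n la lc) : Vec n :=
  S.C x.1 x.2.1 (S.α t x.1) + S.G x.1 + S.M x.1 (S.αDot t x.1 x.2.1) - S.d t

/-- On the set `D`, the actor network with weights `Wa` reproduces `f` up to the error `εa`, and
the critic network with weights `Wc` satisfies the temporal-difference (Bellman) equation up to
the error `ec`. -/
def ApproxOn (D : Set (ℝ × State n la lc)) (Wa : Fin n → Vec la) (Wc : Vec lc) (εa ec : ℝ) :
    Prop :=
  ∀ p ∈ D, ‖S.f p.1 p.2 - S.actorOut p.1 p.2.1 p.2.2.1 Wa‖ ≤ εa ∧ |S.tdError p.1 p.2 Wc| ≤ ec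

/-- Assumptions on the manipulator: regularity, symmetry and uniform positive definiteness of the
inertia matrix, skew-symmetry of `Ṁ - 2C`, and a bounded piecewise continuous disturbance. -/
structure PlantAssumptions (μ₁ μ₂ : ℝ) : Prop where
  M_smooth : ContDiff ℝ 1 S.M
  C_lip : LocallyLipschitz (fun p : Vec n × Vec n => S.C p.1 p.2)
  G_lip : LocallyLipschitz S.G
  μ₁_pos : 0 < μ₁
  μ₂_pos : 0 < μ₂
  M_symm : ∀ q u w, ⟪S.M q u, w⟫ = ⟪u, S.M q w⟫
  M_lower : ∀ q z, μ₁ * ‖z‖ ^ 2 ≤ ⟪z, S.M q z⟫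
  M_upper : ∀ q z, ⟪z, S.M q z⟫ ≤ μ₂ * ‖z‖ ^ 2
  skew : ∀ q v z, ⟪z, (fderiv ℝ S.M q v - (2 : ℝ) • S.C q v) z⟫ = 0
  d_bdd : ∃ b, ∀ t, 0 ≤ t → ‖S.d t‖ ≤ b
  d_pw : ∀ t, 0 ≤ t → ∃ δ > 0, ContinuousOn S.d (Set.Ico t (t + δ))

/-- Assumptions on the reference and the joint limits: the desired trajectory and its velocity are
bounded, it keeps a positive distance from the limits (`k_c` is bounded away from `0`), and
`k_c` and `k̇_c / k_c` are bounded. -/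
structure RefAssumptions (ℓ : ℝ) : Prop where
  qd_smooth : ContDiff ℝ 2 S.qd
  qd_bdd : ∃ b, ∀ t, 0 ≤ t → ‖S.qd t‖ ≤ b ∧ ‖deriv S.qd t‖ ≤ b
  kc_smooth : ContDiff ℝ 2 S.kc
  kc_lower : ∃ b > 0, ∀ t, 0 ≤ t → b ≤ S.kc t
  kc_upper : ∃ b, ∀ t, 0 ≤ t → S.kc t ≤ b
  kc_rate : ∀ t, 0 ≤ t → |deriv S.kc t / S.kc t| ≤ ℓ

/-- Choice of the design parameters. `κ` is a positive lower bound of `K₂ - I/2`; `Sabar` and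
`Scbar` are upper bounds of `‖Sₐ‖²` and `‖S_c‖²`. -/
structure GainAssumptions (κ Sabar Scbar : ℝ) : Prop where
  Tc_pos : 0 < S.Tc
  β_pos : 0 < S.β
  a_pos : 0 < S.a
  K₁_gt : 1 < S.K₁
  κ_pos : 0 < κ
  K₂_lower : ∀ z, κ * ‖z‖ ^ 2 ≤ ⟪z, S.K₂ z⟫ - ‖z‖ ^ 2 / 2
  σa_pos : 0 < S.σa
  σc_pos : 0 < S.σc
  ηa_pos : 0 < S.ηa
  ηc_pos : 0 < S.ηc
  ka_pos : 0 < S.ka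
  ψ_pos : 0 < S.ψ
  Q_psd : S.Q.IsPositive
  R_psd : S.R.IsPositive
  actorWidth_pos : 0 < S.actorWidth
  criticWidth_pos : 0 < S.criticWidth
  Sa_le : ∀ z, ‖S.Sa z‖ ^ 2 ≤ Sabar
  Sc_le : ∀ z, ‖S.Sc z‖ ^ 2 ≤ Scbar
  ηc_gt : 2 * n * S.σa * S.ka ^ 2 * Scbar < S.ηc

/-- The decay rate `ι₁`. -/
noncomputable def ι₁ (μ₂ κ Scbar : ℝ) : ℝ :=
  min (min S.K₁ (2 * κ / μ₂))
    (min (S.σc * (S.ηc - 2 * n * S.σa * S.ka ^ 2 * Scbar)) (S.σa * S.ηa))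

/-- The residual constant `ι₂`. -/
noncomputable def ι₂ (Sabar Scbar : ℝ) (Wa : Fin n → Vec la) (Wc : Vec lc) (εa ec : ℝ) : ℝ :=
  1 / 2 * (S.ηc + 2 * n * S.σa * S.ka ^ 2 * Scbar) * ‖Wc‖ ^ 2
    + S.σa / 2 * (S.ηa + Sabar) * ∑ i, ‖Wa i‖ ^ 2
    + 1 / 4 * ec ^ 2 + 1 / 2 * εa ^ 2 + 1 / (4 * S.a)

/-- The smooth zone barrier Lyapunov function `V₁ = (1 / 2β) ln (k_c² / (k_c² - ‖γ Z₁‖²))`. -/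
noncomputable def V₁ (t : ℝ) (q : Vec n) : ℝ :=
  1 / (2 * S.β) * Real.log (S.kc t ^ 2 / S.gap t q)

/-- The composite Lyapunov function, for ideal weights `Wa`, `Wc`. -/
noncomputable def V (Wa : Fin n → Vec la) (Wc : Vec lc) (t : ℝ) (x : State n la lc) : ℝ :=
  S.V₁ t x.1 + 1 / 2 * ⟪S.Z₂ t x.1 x.2.1, S.M x.1 (S.Z₂ t x.1 x.2.1)⟫
    + 1 / (2 * S.σc) * ‖x.2.2.2 - Wc‖ ^ 2 + 1 / 2 * ∑ i, ‖x.2.2.1 i - Wa i‖ ^ 2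

/-- The operating region of size `(v, z)`: times `t ≥ 0` and states inside the barrier with
`V ≤ v`; as `V` does not control `Z₁` at `t = 0`, where `γ = 0`, the growth of `Z₁` up to the
time `T_c` is limited too. Every initial state belongs to the slice `t = 0` of a region of this
kind, and so does every bounded set of initial states. -/
def region (μ₁ ℓ : ℝ) (Wa : Fin n → Vec la) (Wc : Vec lc) (v z : ℝ) :
    Set (ℝ × State n la lc) :=
  {p | 0 ≤ p.1 ∧ 0 < S.gap p.1 p.2.1 ∧ S.V Wa Wc p.1 p.2 ≤ v ∧
    (p.1 ≤ S.Tc → ‖S.Z₁ p.1 p.2.1‖ ≤ Real.exp (ℓ * p.1) * (z + p.1 * √(2 * v / μ₁)))}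

/-- All closed-loop signals `q, q̇, q̈, Z₁, Z₂, α, α̇, τ, Ŵₐ, Ŵ_c, Ĵ, r, Λ, δ` at time `t` in
state `x` are bounded by `B`. -/
def SignalsLE (t : ℝ) (x : State n la lc) (B : ℝ) : Prop :=
  ‖x.1‖ ≤ B ∧ ‖x.2.1‖ ≤ B ∧ ‖S.accel t x‖ ≤ B ∧ ‖S.Z₁ t x.1‖ ≤ B ∧ ‖S.Z₂ t x.1 x.2.1‖ ≤ B ∧
  ‖S.α t x.1‖ ≤ B ∧ ‖S.αDot t x.1 x.2.1‖ ≤ B ∧ ‖S.τ t x‖ ≤ B ∧ ‖x.2.2.1‖ ≤ B ∧ ‖x.2.2.2‖ ≤ B ∧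
  |S.Jhat t x| ≤ B ∧ |S.cost t x| ≤ B ∧ ‖S.Λ t x‖ ≤ B ∧ |S.tdError t x x.2.2.2| ≤ B

/-- Performance of the state trajectory `x` on the time interval `I`: all signals are bounded by
`Br`, and by `B` from the time `Tr` on; the transformed error stays inside the barrier; the error
bound and the joint limits are respected from the time `T_c` on; and from the time `T' ε` on, `Z₁`
is within `ε` of the ball of radius `k_c √(1 - exp (-2 β c))`. -/
def Performance (I : Set ℝ) (x : ℝ → State n la lc) (c B Br Tr : ℝ) (T' : ℝ → ℝ) : Prop :=
  ∀ t ∈ I, S.SignalsLE t (x t) Br ∧ (Tr ≤ t → S.SignalsLE t (x t) B) ∧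
    ‖S.Zγ t (x t).1‖ < S.kc t ∧
    (S.Tc ≤ t → ‖S.Z₁ t (x t).1‖ < S.kc t ∧ (x t).1 ∈ S.admissible t) ∧
    ∀ ε > 0, T' ε ≤ t → ‖S.Z₁ t (x t).1‖ ≤ S.kc t * √(1 - Real.exp (-(2 * S.β * c))) + ε

end ArmControl

/-!
The proof is a Lyapunov argument for the function `V`, together with a continuation argument for
differential equations whose right-hand side is only right-continuous in time.

*Lyapunov inequality.* Along the closed loop, `V̇ ≤ -ι₁ V + ι₂` wherever the networks approximate
(`hasDerivWithinAt_V`). In the barrier part the second term of `α` absorbs the transient caused by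
`γ̇`, since `s - a s² ≤ 1 / (4 a)`, and `ln y ≤ y - 1` turns the damping into decay of the logarithm
(`hasDerivWithinAt_V₁`). Skew-symmetry of `Ṁ - 2C` reduces the kinetic part to `⟪Z₂, τ - f⟫`
(`hasDerivWithinAt_kinetic`); its coupling to the barrier and to the actor weights cancels against
the other parts, and the cross terms left over are estimated by completing squares.

*Confinement.* Since `γ 0 = 0`, every initial state is inside the barrier. As `V` controls the gap
`k_c² - ‖γ Z₁‖²` from below and decreases on `V = v` when `v > ι₂ / ι₁`, a solution stays in its
operating region (`mem_region_of_isRightSolution`). Before the time `T_c` the barrier says little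
about `Z₁` itself, and the growth estimate `norm_Z₁_le_of_V_le` replaces it.

*Bounds.* On an operating region all signals are bounded (`exists_signalsLE`). The derivative `α̇`
contains `q̈_d` and `k̈_c`, for which no bound is assumed; it is recovered from `f`, which the actor
network reproduces up to a bounded error. Exponential decay of `V` to the level `ι₂ / ι₁`
(`V_le_of_isRightSolution`) gives the ultimate bound and the residual set.

*Existence and uniqueness.* All time dependence of `α` goes through a `C¹` curve of reference
signals, so that `α̇` and then the whole field are functions, Lipschitz in the state, of
signals that are continuous in time, except for the right-continuous disturbance
(`rightRegularAt_field`). The Picard–Lindelöf theorem to the right of each time, uniqueness by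
Grönwall's inequality and the bounds above give global solutions (`exists_isRightSolution_Ici`). No
left limits of the disturbance are needed: a solution has a limit at the end of a bounded interval
because its velocity is bounded.
-/

/-! ### Differential equations with one-sided derivatives -/

section RightODE

open Set Filter Topology
open scoped NNReal

variable {E : Type*} [NormedAddCommGroup E] [NormedSpace ℝ E]

/-- `x` is continuous on `I` and solves `ẋ = g (t, x)` there, with right derivatives. -/
def IsRightSolution (g : ℝ → E → E) (I : Set ℝ) (x : ℝ → E) : Prop :=
  ContinuousOn x I ∧ ∀ t ∈ I, HasDerivWithinAt x (g t (x t)) (Ici t) t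

/-- The hypotheses of the Picard–Lindelöf theorem to the right of `(t₀, x₀)`: on a short interval
`[t₀, t₀ + δ]` and a small ball around `x₀`, the function `g` is continuous in time and uniformly
Lipschitz in space. The codomain is arbitrary, so that the property can be established for the
ingredients of a vector field first. -/
def RightRegularAt {X F : Type*} [PseudoMetricSpace X] [PseudoMetricSpace F] (g : ℝ → X → F)
    (t₀ : ℝ) (x₀ : X) : Prop :=
  ∃ δ > 0, ∃ ρ > 0, ∃ K : ℝ≥0,
    (∀ t ∈ Icc t₀ (t₀ + δ), LipschitzOnWith K (g t) (Metric.closedBall x₀ ρ)) ∧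
    ∀ x ∈ Metric.closedBall x₀ ρ, ContinuousOn (g · x) (Icc t₀ (t₀ + δ))

variable {g : ℝ → E → E} {x y : ℝ → E} {t₀ T : ℝ} {x₀ : E}

theorem IsRightSolution.mono {I J : Set ℝ} (h : IsRightSolution g I x) (hJ : J ⊆ I) :
    IsRightSolution g J x :=
  ⟨h.1.mono hJ, fun t ht => h.2 t (hJ ht)⟩

theorem RightRegularAt.exists_solution [CompleteSpace E] (h : RightRegularAt g t₀ x₀) :
    ∃ δ > 0, ∃ y : ℝ → E, y t₀ = x₀ ∧ IsRightSolution g (Ico t₀ (t₀ + δ)) y := by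
  obtain ⟨δ, hδ, ρ, hρ, K, hK, hc⟩ := h
  obtain ⟨b, hb⟩ := isCompact_Icc.exists_bound_of_continuousOn
    (hc x₀ (Metric.mem_closedBall_self hρ.le))
  have hb0 : 0 ≤ b := (norm_nonneg _).trans (hb t₀ ⟨le_rfl, by linarith⟩)
  have hL0 : 0 < b + K * ρ + 1 := by positivity
  -- the solution cannot leave the ball of radius `ρ` before time `ρ / L`
  set L : ℝ := b + K * ρ + 1 with hL
  set δ' : ℝ := min δ (ρ / L) with hδ'
  have hδ'0 : 0 < δ' := lt_min hδ (by positivity)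
  have hsub : Icc t₀ (t₀ + δ') ⊆ Icc t₀ (t₀ + δ) :=
    Icc_subset_Icc_right (by linarith [min_le_left δ (ρ / L)])
  have hPL : IsPicardLindelof g (tmin := t₀) (tmax := t₀ + δ') ⟨t₀, le_rfl, by linarith⟩ x₀
      ⟨ρ, hρ.le⟩ 0 ⟨L, hL0.le⟩ K := by
    refine ⟨fun t ht => hK t (hsub ht), fun x hx => (hc x hx).mono hsub, fun t ht x hx => ?_, ?_⟩
    · have h1 := (hK t (hsub ht)).dist_le_mul x hx x₀ (Metric.mem_closedBall_self hρ.le)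
      have h2 : dist x x₀ ≤ ρ := hx
      have h3 := hb t (hsub ht)
      have h4 : ‖g t x‖ ≤ ‖g t x₀‖ + dist (g t x) (g t x₀) := by
        rw [dist_eq_norm]; exact norm_le_insert' _ _
      have h5 : (K : ℝ) * dist x x₀ ≤ K * ρ := by gcongr
      change ‖g t x‖ ≤ L
      linarith
    · change L * max (t₀ + δ' - t₀) (t₀ - t₀) ≤ ρ - 0
      rw [add_sub_cancel_left, sub_self, max_eq_left hδ'0.le, sub_zero]
      calc L * δ' ≤ L * (ρ / L) := by gcongr; exact min_le_right _ _
        _ = ρ := by field_simp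
  obtain ⟨y, hy0, hy⟩ := hPL.exists_eq_forall_mem_Icc_hasDerivWithinAt₀
  refine ⟨δ', hδ'0, y, hy0, fun t ht => ?_, fun t ht => ?_⟩
  · exact (hy t (Ico_subset_Icc_self ht)).continuousWithinAt.mono Ico_subset_Icc_self
  · refine (hy t (Ico_subset_Icc_self ht)).mono_of_mem_nhdsWithin ?_
    exact mem_of_superset (Icc_mem_nhdsGE ht.2) (Icc_subset_Icc_left ht.1)

theorem IsRightSolution.continuousWithinAt_Ici (h : IsRightSolution g (Ico t₀ T) x) {t : ℝ}
    (ht : t ∈ Ico t₀ T) : ContinuousWithinAt x (Ici t) t :=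
  (h.2 t ht).continuousWithinAt

theorem RightRegularAt.eventually_eq (h : RightRegularAt g t₀ x₀) (hT : t₀ < T)
    (hx : IsRightSolution g (Ico t₀ T) x) (hy : IsRightSolution g (Ico t₀ T) y)
    (hx0 : x t₀ = x₀) (hy0 : y t₀ = x₀) : ∀ᶠ t in 𝓝[>] t₀, x t = y t := by
  obtain ⟨δ, hδ, ρ, hρ, K, hK, -⟩ := h
  have hmem : ∀ {w : ℝ → E}, IsRightSolution g (Ico t₀ T) w → w t₀ = x₀ →
      ∀ᶠ t in 𝓝[≥] t₀, w t ∈ Metric.closedBall x₀ ρ := fun {w} hw hw0 =>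
    hw.continuousWithinAt_Ici ⟨le_rfl, hT⟩
      (by rw [hw0]; exact Metric.closedBall_mem_nhds _ hρ)
  obtain ⟨u, hu, hsub⟩ := mem_nhdsGE_iff_exists_Icc_subset.1
    (inter_mem (hmem hx hx0) (inter_mem (hmem hy hy0)
      (Icc_mem_nhdsGE (lt_min hT (lt_add_of_pos_right t₀ hδ)))))
  have hu' : t₀ < u := hu
  -- shrink once more so that the closed interval lies in `[t₀, T)`
  have hev : ∀ᶠ b in 𝓝[>] t₀, b < T ∧ b ≤ t₀ + δ ∧ b < u := by
    filter_upwards [Ioo_mem_nhdsGT (lt_min hT (lt_min (lt_add_of_pos_right t₀ hδ) hu'))] with b hb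
    have := hb.2
    simp only [lt_min_iff] at this
    exact ⟨this.1, this.2.1.le, this.2.2⟩
  filter_upwards [hev, self_mem_nhdsWithin] with b hb hb0
  have hb0 : t₀ < b := hb0
  have hI : Icc t₀ b ⊆ Ico t₀ T := fun s hs => ⟨hs.1, hs.2.trans_lt hb.1⟩
  have hI' : Ico t₀ b ⊆ Ico t₀ T := fun s hs => ⟨hs.1, hs.2.trans hb.1⟩
  refine ODE_solution_unique_of_mem_Icc_right (v := g) (K := K)
    (s := fun _ => Metric.closedBall x₀ ρ) (a := t₀) (b := b) ?_ (hx.1.mono hI)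
    (fun t ht => hx.2 t (hI' ht)) ?_ (hy.1.mono hI) (fun t ht => hy.2 t (hI' ht)) ?_
    (by rw [hx0, hy0]) ⟨hb0.le, le_rfl⟩
  · exact fun t ht => hK t ⟨ht.1, ht.2.le.trans hb.2.1⟩
  · exact fun t ht => (hsub ⟨ht.1, ht.2.le.trans hb.2.2.le⟩).1
  · exact fun t ht => (hsub ⟨ht.1, ht.2.le.trans hb.2.2.le⟩).2.1

theorem IsRightSolution.eqOn (hwp : ∀ t ∈ Ico t₀ T, RightRegularAt g t (x t))
    (hx : IsRightSolution g (Ico t₀ T) x) (hy : IsRightSolution g (Ico t₀ T) y)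
    (h0 : x t₀ = y t₀) : EqOn x y (Ico t₀ T) := by
  intro b hb
  have hI : Icc t₀ b ⊆ Ico t₀ T := fun s hs => ⟨hs.1, hs.2.trans_lt hb.2⟩
  have hcl : IsClosed ({t | x t = y t} ∩ Icc t₀ b) := by
    have := ((hx.1.mono hI).sub (hy.1.mono hI)).preimage_isClosed_of_isClosed isClosed_Icc
      (isClosed_singleton (x := (0 : E)))
    convert this using 1
    ext t
    simp [sub_eq_zero, and_comm]
  refine hcl.Icc_subset_of_forall_mem_nhdsWithin h0 (fun t ht => ?_) (right_mem_Icc.2 hb.1)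
  have htT : t ∈ Ico t₀ T := hI (Ico_subset_Icc_self ht.2)
  exact (hwp t htT).eventually_eq htT.2 (hx.mono (Ico_subset_Ico_left htT.1))
    (hy.mono (Ico_subset_Ico_left htT.1)) rfl ht.1.symm

/-- Right solutions with bounded velocity have a limit at the end of a bounded interval. -/
theorem IsRightSolution.exists_tendsto [CompleteSpace E] (hT : t₀ < T)
    (hx : IsRightSolution g (Ico t₀ T) x) {L : ℝ} (hL : ∀ t ∈ Ico t₀ T, ‖g t (x t)‖ ≤ L) :
    ∃ e, Tendsto x (𝓝[<] T) (𝓝 e) := by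
  have hL0 : 0 ≤ L := (norm_nonneg _).trans (hL t₀ ⟨le_rfl, hT⟩)
  have hlip : ∀ s ∈ Ico t₀ T, ∀ t ∈ Ico t₀ T, s ≤ t → ‖x t - x s‖ ≤ L * (t - s) := by
    intro s hs t ht hst
    have hI : Icc s t ⊆ Ico t₀ T := fun u hu => ⟨hs.1.trans hu.1, hu.2.trans_lt ht.2⟩
    exact norm_image_sub_le_of_norm_deriv_right_le_segment (hx.1.mono hI)
      (fun u hu => hx.2 u (hI (Ico_subset_Icc_self hu)))
      (fun u hu => hL u (hI (Ico_subset_Icc_self hu))) t ⟨hst, le_rfl⟩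
  have hc : Cauchy (map x (𝓝[<] T)) := by
    rw [Metric.cauchy_iff]
    refine ⟨inferInstance, fun ε hε => ?_⟩
    set η := ε / (L + 1) with hη
    have hη0 : 0 < η := by positivity
    refine ⟨x '' Ioo (max t₀ (T - η)) T,
      image_mem_map (Ioo_mem_nhdsLT (max_lt hT (by linarith))), ?_⟩
    have key : ∀ s ∈ Ioo (max t₀ (T - η)) T, ∀ t ∈ Ioo (max t₀ (T - η)) T, s ≤ t →
        ‖x t - x s‖ < ε := by
      intro s hs t ht hst
      have hs1 := max_lt_iff.1 hs.1
      have ht1 := max_lt_iff.1 ht.1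
      calc ‖x t - x s‖ ≤ L * (t - s) := hlip s ⟨hs1.1.le, hs.2⟩ t ⟨ht1.1.le, ht.2⟩ hst
        _ ≤ L * η := by gcongr; linarith [ht.2, hs1.2]
        _ < (L + 1) * η := by nlinarith
        _ = ε := by rw [hη]; field_simp
    rintro _ ⟨s, hs, rfl⟩ _ ⟨t, ht, rfl⟩
    rcases le_total s t with hst | hst
    · rw [dist_comm, dist_eq_norm]; exact key s hs t ht hst
    · rw [dist_eq_norm]; exact key t ht s hs hst
  exact CompleteSpace.complete hc

/-- Continuation of solutions: if solutions from `x₀` are unique, and each solution on a bounded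
interval has a limit at the end from which the equation can be solved further, then there is a
solution on `[0, ∞)`. -/
theorem exists_isRightSolution_Ici [CompleteSpace E] (h₀ : RightRegularAt g 0 x₀)
    (huniq : ∀ T x y, IsRightSolution g (Ico 0 T) x → IsRightSolution g (Ico 0 T) y → x 0 = x₀ →
      y 0 = x₀ → EqOn x y (Ico 0 T))
    (hlim : ∀ T x, 0 < T → IsRightSolution g (Ico 0 T) x → x 0 = x₀ →
      ∃ e, Tendsto x (𝓝[<] T) (𝓝 e) ∧ RightRegularAt g T e) :
    ∃ x, IsRightSolution g (Ici 0) x ∧ x 0 = x₀ := by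
  classical
  -- glue all solutions into one curve
  let P : ℝ → (ℝ → E) → Prop := fun T y => 0 < T ∧ y 0 = x₀ ∧ IsRightSolution g (Ico 0 T) y
  let X : ℝ → E := fun t => if h : ∃ p : ℝ × (ℝ → E), t < p.1 ∧ P p.1 p.2 then h.choose.2 t else x₀
  have hX : ∀ T y, P T y → EqOn X y (Ico 0 T) := by
    intro T y hy t ht
    have h : ∃ p : ℝ × (ℝ → E), t < p.1 ∧ P p.1 p.2 := ⟨(T, y), ht.2, hy⟩
    have hXt : X t = h.choose.2 t := dif_pos h
    obtain ⟨h1, h2⟩ := h.choose_spec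
    rw [hXt]
    refine huniq (min T h.choose.1) _ _ (h2.2.2.mono (Ico_subset_Ico_right (min_le_right _ _)))
      (hy.2.2.mono (Ico_subset_Ico_right (min_le_left _ _))) h2.2.1 hy.2.1 ⟨ht.1, lt_min ht.2 h1⟩
  have hXat : ∀ T y, P T y → ∀ t ∈ Ico 0 T,
      ContinuousWithinAt X (Ici 0) t ∧ HasDerivWithinAt X (g t (X t)) (Ici t) t := by
    intro T y hy t ht
    have heq := hX T y hy
    constructor
    · have h1 : ContinuousWithinAt X (Ico 0 T) t :=
        (hy.2.2.1 t ht).congr heq (heq ht)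
      exact h1.mono_of_mem_nhdsWithin
        (by rw [← Ici_inter_Iio]; exact inter_mem_nhdsWithin _ (Iio_mem_nhds ht.2))
    · rw [heq ht]
      refine (hy.2.2.2 t ht).congr_of_eventuallyEq ?_ (heq ht)
      filter_upwards [Ico_mem_nhdsGE ht.2] with s hs using heq ⟨ht.1.trans hs.1, hs.2⟩
  have hX0 : X 0 = x₀ := by
    obtain ⟨δ, hδ, y, hy0, hy⟩ := h₀.exists_solution
    rw [zero_add] at hy
    rw [hX δ y ⟨hδ, hy0, hy⟩ ⟨le_rfl, hδ⟩, hy0]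
  have hlong : ∀ t, ∃ T y, t < T ∧ P T y := by
    by_contra! hcon
    obtain ⟨b, hb⟩ := hcon
    set A : Set ℝ := {T | ∃ y, P T y} with hA
    have hne : A.Nonempty := by
      obtain ⟨δ, hδ, y, hy0, hy⟩ := h₀.exists_solution
      exact ⟨δ, y, hδ, hy0, by rwa [zero_add] at hy⟩
    have hbd : BddAbove A := ⟨b, fun T ⟨y, hy⟩ => not_lt.1 fun hlt => hb T y hlt hy⟩
    set T := sSup A with hTdef
    have hT0 : 0 < T := by
      obtain ⟨T', y, hy⟩ := hne
      exact hy.1.trans_le (le_csSup hbd ⟨y, hy⟩)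
    have hsol : IsRightSolution g (Ico 0 T) X := by
      have : ∀ t ∈ Ico 0 T, ContinuousWithinAt X (Ici 0) t ∧
          HasDerivWithinAt X (g t (X t)) (Ici t) t := by
        intro t ht
        obtain ⟨T', ⟨y, hy⟩, hlt⟩ := exists_lt_of_lt_csSup hne ht.2
        exact hXat T' y hy t ⟨ht.1, hlt⟩
      exact ⟨fun t ht => (this t ht).1.mono Ico_subset_Ici_self, fun t ht => (this t ht).2⟩
    obtain ⟨e, he, hwp⟩ := hlim T X hT0 hsol hX0
    obtain ⟨δ, hδ, y, hy0, hy⟩ := hwp.exists_solution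
    -- extend the glued curve beyond `T` by a local solution from its limit
    let Y : ℝ → E := fun t => if t < T then X t else y t
    have hYX : ∀ t, t < T → Y t = X t := fun t ht => if_pos ht
    have hYy : ∀ t, T ≤ t → Y t = y t := fun t ht => if_neg (not_lt.2 ht)
    have hYsol : P (T + δ) Y := by
      refine ⟨by linarith, by rw [hYX 0 hT0, hX0], fun t ht => ?_, fun t ht => ?_⟩
      · rcases lt_trichotomy t T with h | h | h
        · have h1 := (hsol.1 t ⟨ht.1, h⟩)
          have h2 : ContinuousWithinAt Y (Ico 0 T) t :=
            h1.congr (fun s hs => hYX s hs.2) (hYX t h)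
          refine h2.mono_of_mem_nhdsWithin ?_
          filter_upwards [self_mem_nhdsWithin, mem_nhdsWithin_of_mem_nhds (Iio_mem_nhds h)]
            with s hs1 hs2 using ⟨hs1.1, hs2⟩
        · subst h
          have hl : ContinuousWithinAt Y (Iio T) T := by
            rw [ContinuousWithinAt, hYy T le_rfl, hy0]
            refine he.congr' ?_
            filter_upwards [self_mem_nhdsWithin] with s hs using (hYX s hs).symm
          have hr : ContinuousWithinAt Y (Ici T) T :=
            (hy.continuousWithinAt_Ici ⟨le_rfl, by linarith⟩).congr (fun s hs => hYy s hs)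
              (hYy T le_rfl)
          exact (hl.union hr).mono (by rw [Iio_union_Ici]; exact subset_univ _)
        · have h1 := (hy.1 t ⟨h.le, ht.2⟩)
          have h2 : ContinuousWithinAt Y (Ico T (T + δ)) t :=
            h1.congr (fun s hs => hYy s hs.1) (hYy t h.le)
          refine h2.mono_of_mem_nhdsWithin ?_
          filter_upwards [self_mem_nhdsWithin, mem_nhdsWithin_of_mem_nhds (Ioi_mem_nhds h)]
            with s hs1 hs2 using ⟨le_of_lt hs2, hs1.2⟩
      · rcases lt_or_ge t T with h | h
        · rw [hYX t h]
          refine (hsol.2 t ⟨ht.1, h⟩).congr_of_eventuallyEq ?_ (hYX t h)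
          filter_upwards [Ico_mem_nhdsGE h] with s hs using hYX s hs.2
        · rw [hYy t h]
          exact (hy.2 t ⟨h, ht.2⟩).congr (fun s hs => hYy s (h.trans hs)) (hYy t h)
    linarith [le_csSup hbd ⟨Y, hYsol⟩]
  refine ⟨X, ⟨fun t ht => ?_, fun t ht => ?_⟩, hX0⟩
  · obtain ⟨T, y, hlt, hy⟩ := hlong t
    exact (hXat T y hy t ⟨ht, hlt⟩).1
  · obtain ⟨T, y, hlt, hy⟩ := hlong t
    exact (hXat T y hy t ⟨ht, hlt⟩).2

end RightODE

/-! ### Functions that are Lipschitz in space and right-continuous in time -/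

section RightRegular

open Set Filter Topology
open scoped NNReal

variable {X F G : Type*} [PseudoMetricSpace X] [PseudoMetricSpace F] [PseudoMetricSpace G]
  {g : ℝ → X → F} {h : ℝ → X → G} {t₀ : ℝ} {x₀ : X}

theorem RightRegularAt.shrink (hg : RightRegularAt g t₀ x₀) :
    ∃ δ > 0, ∃ ρ > 0, ∃ K : ℝ≥0, ∀ δ' ≤ δ, ∀ ρ' ≤ ρ,
      (∀ t ∈ Icc t₀ (t₀ + δ'), LipschitzOnWith K (g t) (Metric.closedBall x₀ ρ')) ∧
      ∀ x ∈ Metric.closedBall x₀ ρ', ContinuousOn (g · x) (Icc t₀ (t₀ + δ')) := by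
  obtain ⟨δ, hδ, ρ, hρ, K, hK, hc⟩ := hg
  refine ⟨δ, hδ, ρ, hρ, K, fun δ' hδ' ρ' hρ' => ⟨fun t ht => ?_, fun x hx => ?_⟩⟩
  · exact (hK t (Icc_subset_Icc_right (by linarith) ht)).mono (Metric.closedBall_subset_closedBall hρ')
  · exact (hc x (Metric.closedBall_subset_closedBall hρ' hx)).mono
      (Icc_subset_Icc_right (by linarith))

theorem RightRegularAt.prodMk (hg : RightRegularAt g t₀ x₀) (hh : RightRegularAt h t₀ x₀) :
    RightRegularAt (fun t x => (g t x, h t x)) t₀ x₀ := by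
  obtain ⟨δ₁, hδ₁, ρ₁, hρ₁, K₁, h₁⟩ := hg.shrink
  obtain ⟨δ₂, hδ₂, ρ₂, hρ₂, K₂, h₂⟩ := hh.shrink
  obtain ⟨h₁, h₁'⟩ := h₁ _ (min_le_left δ₁ δ₂) _ (min_le_left ρ₁ ρ₂)
  obtain ⟨h₂, h₂'⟩ := h₂ _ (min_le_right δ₁ δ₂) _ (min_le_right ρ₁ ρ₂)
  exact ⟨_, lt_min hδ₁ hδ₂, _, lt_min hρ₁ hρ₂, max K₁ K₂,
    fun t ht => (h₁ t ht).prodMk (h₂ t ht), fun x hx => (h₁' x hx).prodMk (h₂' x hx)⟩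

theorem RightRegularAt.comp {Φ : F → G} (hg : RightRegularAt g t₀ x₀)
    (hΦ : ∃ K : ℝ≥0, ∃ U ∈ 𝓝 (g t₀ x₀), LipschitzOnWith K Φ U) :
    RightRegularAt (fun t x => Φ (g t x)) t₀ x₀ := by
  obtain ⟨δ, hδ, ρ, hρ, K, hs⟩ := hg.shrink
  obtain ⟨K', U, hU, hΦ⟩ := hΦ
  obtain ⟨ε, hε, hball⟩ := Metric.mem_nhds_iff.1 hU
  obtain ⟨hK, hc⟩ := hs δ le_rfl ρ le_rfl
  have h0 : x₀ ∈ Metric.closedBall x₀ ρ := Metric.mem_closedBall_self hρ.le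
  -- in time, `g · x₀` moves by less than `ε / 2`; in space, `g t` moves by at most `K ρ' < ε / 2`
  have hev : ∀ᶠ t in 𝓝[≥] t₀, dist (g t x₀) (g t₀ x₀) < ε / 2 := by
    have h1 : ContinuousWithinAt (g · x₀) (Icc t₀ (t₀ + δ)) t₀ :=
      hc x₀ h0 t₀ ⟨le_rfl, by linarith⟩
    have h2 : ContinuousWithinAt (g · x₀) (Ici t₀) t₀ :=
      h1.mono_of_mem_nhdsWithin (Icc_mem_nhdsGE (lt_add_of_pos_right t₀ hδ))
    exact h2 (Metric.ball_mem_nhds _ (by positivity))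
  obtain ⟨u, hu, hsub⟩ := mem_nhdsGE_iff_exists_Icc_subset.1 hev
  have hu' : t₀ < u := hu
  set δ' := min δ (u - t₀) with hδ'
  set ρ' := min ρ (ε / 2 / (K + 1)) with hρ'
  obtain ⟨hK', hc'⟩ := hs δ' (min_le_left _ _) ρ' (min_le_left _ _)
  have hρ'0 : 0 < ρ' := lt_min hρ (by positivity)
  have hmaps : ∀ t ∈ Icc t₀ (t₀ + δ'), MapsTo (g t) (Metric.closedBall x₀ ρ') U := by
    intro t ht x hx
    refine hball ?_
    have h1 := (hK' t ht).dist_le_mul x hx x₀ (Metric.mem_closedBall_self hρ'0.le)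
    have h2 : dist (g t x₀) (g t₀ x₀) < ε / 2 :=
      hsub ⟨ht.1, by linarith [ht.2, min_le_right δ (u - t₀)]⟩
    have h3 : (K : ℝ) * dist x x₀ ≤ K * ρ' := by gcongr; exact hx
    have h4 : (K : ℝ) * ρ' ≤ (K + 1) * (ε / 2 / (K + 1)) := by
      gcongr
      · linarith
      · exact min_le_right _ _
    have h5 : ((K : ℝ) + 1) * (ε / 2 / (K + 1)) = ε / 2 := by field_simp
    rw [Metric.mem_ball]
    linarith [dist_triangle (g t x) (g t x₀) (g t₀ x₀)]
  refine ⟨δ', lt_min hδ (by linarith), ρ', hρ'0, K' * K, fun t ht => ?_, fun x hx => ?_⟩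
  · exact hΦ.comp (hK' t ht) (hmaps t ht)
  · exact hΦ.continuousOn.comp (hc' x hx) fun t ht => hmaps t ht hx

theorem RightRegularAt.congr {h : ℝ → X → F} (hg : RightRegularAt g t₀ x₀)
    (heq : ∀ᶠ p : ℝ × X in 𝓝 (t₀, x₀), t₀ ≤ p.1 → h p.1 p.2 = g p.1 p.2) :
    RightRegularAt h t₀ x₀ := by
  obtain ⟨δ, hδ, ρ, hρ, K, hs⟩ := hg.shrink
  obtain ⟨ε, hε, hball⟩ := Metric.eventually_nhds_iff_ball.1 heq
  obtain ⟨hK, hc⟩ := hs (min δ (ε / 2)) (min_le_left _ _) (min ρ (ε / 2)) (min_le_left _ _)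
  have hE : ∀ t ∈ Icc t₀ (t₀ + min δ (ε / 2)), ∀ x ∈ Metric.closedBall x₀ (min ρ (ε / 2)),
      h t x = g t x := by
    intro t ht x hx
    refine hball (t, x) ?_ ht.1
    have h1 : dist x x₀ ≤ ε / 2 := le_trans hx (min_le_right _ _)
    have h2 : dist t t₀ ≤ ε / 2 := by
      rw [Real.dist_eq, abs_of_nonneg (by linarith [ht.1])]
      linarith [ht.2, min_le_right δ (ε / 2)]
    rw [Metric.mem_ball, Prod.dist_eq]
    exact (max_le h2 h1).trans_lt (half_lt_self hε)
  refine ⟨_, lt_min hδ (half_pos hε), _, lt_min hρ (half_pos hε), K, fun t ht => ?_, fun x hx => ?_⟩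
  · intro x hx y hy
    rw [hE t ht x hx, hE t ht y hy]
    exact hK t ht hx hy
  · exact (hc x hx).congr fun t ht => hE t ht x hx

theorem RightRegularAt.of_time {c : ℝ → F} (hc : ∃ δ > 0, ContinuousOn c (Ico t₀ (t₀ + δ))) :
    RightRegularAt (fun t (_ : X) => c t) t₀ x₀ := by
  obtain ⟨δ, hδ, hc⟩ := hc
  exact ⟨δ / 2, by positivity, 1, one_pos, 0, fun t _ => (LipschitzWith.const _).lipschitzOnWith,
    fun x _ => hc.mono fun s hs => ⟨hs.1, by linarith [hs.2]⟩⟩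

theorem RightRegularAt.of_continuous {c : ℝ → F} (hc : Continuous c) :
    RightRegularAt (fun t (_ : X) => c t) t₀ x₀ :=
  .of_time ⟨1, one_pos, hc.continuousOn⟩

theorem RightRegularAt.id : RightRegularAt (fun (_ : ℝ) (x : X) => x) t₀ x₀ :=
  ⟨1, one_pos, 1, one_pos, 1, fun _ _ => LipschitzWith.id.lipschitzOnWith,
    fun _ _ => continuousOn_const⟩

end RightRegular

section RightRegularSmooth

variable {X F G : Type*} [PseudoMetricSpace X] [NormedAddCommGroup F] [NormedSpace ℝ F]
  [NormedAddCommGroup G] [NormedSpace ℝ G] {g : ℝ → X → F} {t₀ : ℝ} {x₀ : X}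

theorem RightRegularAt.comp_contDiffAt {Φ : F → G} (hg : RightRegularAt g t₀ x₀)
    (hΦ : ContDiffAt ℝ 1 Φ (g t₀ x₀)) : RightRegularAt (fun t x => Φ (g t x)) t₀ x₀ :=
  hg.comp hΦ.exists_lipschitzOnWith

theorem RightRegularAt.add {h : ℝ → X → F} (hg : RightRegularAt g t₀ x₀)
    (hh : RightRegularAt h t₀ x₀) : RightRegularAt (fun t x => g t x + h t x) t₀ x₀ :=
  (hg.prodMk hh).comp_contDiffAt (Φ := fun p : F × F => p.1 + p.2) (by fun_prop)

theorem RightRegularAt.sub {h : ℝ → X → F} (hg : RightRegularAt g t₀ x₀)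
    (hh : RightRegularAt h t₀ x₀) : RightRegularAt (fun t x => g t x - h t x) t₀ x₀ :=
  (hg.prodMk hh).comp_contDiffAt (Φ := fun p : F × F => p.1 - p.2) (by fun_prop)

end RightRegularSmooth

/-! ### Regularity of the shifting function -/

section Shift

theorem hasDerivAt_max_zero_pow (k : ℕ) (u : ℝ) :
    HasDerivAt (fun u : ℝ => max u 0 ^ (k + 2)) ((k + 2) * max u 0 ^ (k + 1)) u := by
  rcases lt_trichotomy u 0 with h | h | h
  · have : (fun u : ℝ => max u 0 ^ (k + 2)) =ᶠ[nhds u] fun _ => 0 := by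
      filter_upwards [Iio_mem_nhds h] with s hs
      rw [max_eq_right (le_of_lt hs)]; simp
    rw [max_eq_right h.le]
    simpa using (hasDerivAt_const u (0 : ℝ)).congr_of_eventuallyEq this
  · subst h
    have h1 : HasDerivAt (fun u : ℝ => u ^ (k + 2)) 0 0 := by
      simpa using hasDerivAt_pow (k + 2) (0 : ℝ)
    have hl : HasDerivWithinAt (fun u : ℝ => max u 0 ^ (k + 2)) 0 (Set.Iic 0) 0 :=
      (hasDerivWithinAt_const _ _ (0 : ℝ)).congr
        (fun s hs => by rw [max_eq_right hs]; simp) (by simp)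
    have hr : HasDerivWithinAt (fun u : ℝ => max u 0 ^ (k + 2)) 0 (Set.Ici 0) 0 :=
      h1.hasDerivWithinAt.congr (fun s hs => by rw [max_eq_left hs]) (by simp)
    have := hl.union hr
    rw [Set.Iic_union_Ici, hasDerivWithinAt_univ] at this
    simpa using this
  · have : (fun u : ℝ => max u 0 ^ (k + 2)) =ᶠ[nhds u] fun u => u ^ (k + 2) := by
      filter_upwards [Ioi_mem_nhds h] with s hs
      rw [max_eq_left (le_of_lt hs)]
    rw [max_eq_left h.le]
    have h2 := (hasDerivAt_pow (k + 2) u).congr_of_eventuallyEq this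
    simpa using h2

variable {Tc : ℝ}

theorem shift_eq_max (Tc t : ℝ) :
    shift Tc t = 1 - max (Tc - t) 0 ^ (1 + 2) / Tc ^ 3 := by
  unfold shift
  split_ifs with h
  · rw [max_eq_left (by linarith), div_pow]
  · rw [max_eq_right (by linarith)]; simp

theorem shiftRate_eq_max (Tc t : ℝ) :
    shiftRate Tc t = 3 * max (Tc - t) 0 ^ (0 + 2) / Tc ^ 3 := by
  unfold shiftRate
  split_ifs with h
  · rw [max_eq_left (by linarith)]
  · rw [max_eq_right (by linarith)]; simp

theorem hasDerivAt_shift (Tc t : ℝ) : HasDerivAt (shift Tc) (shiftRate Tc t) t := by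
  rw [funext (shift_eq_max Tc), shiftRate_eq_max Tc]
  have h := (hasDerivAt_max_zero_pow 1 (Tc - t)).comp t ((hasDerivAt_id t).const_sub Tc)
  refine ((h.div_const (Tc ^ 3)).const_sub 1).congr_deriv ?_
  push_cast
  ring

theorem contDiff_shiftRate (Tc : ℝ) : ContDiff ℝ 1 (shiftRate Tc) := by
  have h : ∀ t, HasDerivAt (shiftRate Tc) (-(6 * max (Tc - t) 0 / Tc ^ 3)) t := by
    intro t
    rw [funext (shiftRate_eq_max Tc)]
    have h := (hasDerivAt_max_zero_pow 0 (Tc - t)).comp t ((hasDerivAt_id t).const_sub Tc)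
    refine ((h.const_mul 3).div_const (Tc ^ 3)).congr_deriv ?_
    push_cast
    ring
  rw [contDiff_one_iff_deriv]
  refine ⟨fun t => (h t).differentiableAt, ?_⟩
  rw [funext fun t => (h t).deriv]
  fun_prop

theorem contDiff_shift (Tc : ℝ) : ContDiff ℝ 1 (shift Tc) := by
  rw [contDiff_one_iff_deriv]
  refine ⟨fun t => (hasDerivAt_shift Tc t).differentiableAt, ?_⟩
  rw [funext fun t => (hasDerivAt_shift Tc t).deriv]
  exact (contDiff_shiftRate Tc).continuous

theorem shift_zero (hTc : 0 < Tc) : shift Tc 0 = 0 := by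
  simp [shift, hTc, hTc.ne']

theorem shift_of_le {t : ℝ} (h : Tc ≤ t) : shift Tc t = 1 := by
  simp [shift, not_lt.2 h]

theorem abs_shift_le_one (hTc : 0 < Tc) {t : ℝ} (ht : 0 ≤ t) : |shift Tc t| ≤ 1 := by
  unfold shift
  split_ifs with h
  · have h1 : 0 ≤ (Tc - t) / Tc := by apply div_nonneg <;> linarith
    have h2 : (Tc - t) / Tc ≤ 1 := by rw [div_le_one hTc]; linarith
    have h3 : ((Tc - t) / Tc) ^ 3 ≤ 1 := pow_le_one₀ h1 h2
    have h4 : 0 ≤ ((Tc - t) / Tc) ^ 3 := by positivity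
    rw [abs_le]; constructor <;> linarith
  · simp

theorem abs_shiftRate_le (hTc : 0 < Tc) {t : ℝ} (ht : 0 ≤ t) : |shiftRate Tc t| ≤ 3 / Tc := by
  unfold shiftRate
  split_ifs with h
  · have h1 : (Tc - t) ^ 2 ≤ Tc ^ 2 := by gcongr; linarith
    rw [abs_of_nonneg (by positivity)]
    calc 3 * (Tc - t) ^ 2 / Tc ^ 3 ≤ 3 * Tc ^ 2 / Tc ^ 3 := by gcongr
      _ = 3 / Tc := by field_simp
  · rw [abs_zero]; positivity

end Shift

/-! ### Regularity of the radial basis functions and of the closed-loop field -/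

theorem contDiff_rbf {P : Type*} [NormedAddCommGroup P] [InnerProductSpace ℝ P] {k : ℕ}
    (c : Fin k → P) (w : ℝ) (n : WithTop ℕ∞) : ContDiff ℝ n (rbf c w) := by
  refine PiLp.contDiff_toLp.comp (contDiff_pi.2 fun j => ?_)
  exact (((contDiff_id.sub contDiff_const).norm_sq ℝ).div_const _).neg.exp

namespace ArmControl

variable {n la lc : ℕ} (S : ArmControl n la lc)

/-- Values of the time-dependent signals entering the virtual control:
`(q_d, q̇_d, k_c, k̇_c, γ, γ̇)`. -/
abbrev RefSignals (n : ℕ) := Vec n × Vec n × ℝ × ℝ × ℝ × ℝ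

/-- The signals `(q_d, q̇_d, k_c, k̇_c, γ, γ̇)` at time `t`. -/
noncomputable def refSignals (t : ℝ) : RefSignals n :=
  (S.qd t, deriv S.qd t, S.kc t, deriv S.kc t, shift S.Tc t, shiftRate S.Tc t)

/-- The virtual control as a smooth function of the reference signals and the position. All time
dependence of `α` goes through `refSignals`, which is `C¹`; this exhibits `α̇` as a `C¹` function
of signals that are continuous in time. -/
noncomputable def αRef (p : RefSignals n × Vec n) : Vec n :=
  -(S.K₁ • (p.2 - p.1.1))
    - (S.a * p.1.2.2.2.2.2 ^ 2 * ‖p.2 - p.1.1‖ ^ 2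
        / (S.β * (p.1.2.2.1 ^ 2 - ‖p.1.2.2.2.2.1 • (p.2 - p.1.1)‖ ^ 2))) • (p.2 - p.1.1)
    + p.1.2.1 + (p.1.2.2.2.1 / p.1.2.2.1) • (p.2 - p.1.1)

variable {S}
variable {μ₁ μ₂ ℓ κ Sabar Scbar : ℝ}

theorem RefAssumptions.kc_pos (href : S.RefAssumptions ℓ) {t : ℝ} (ht : 0 ≤ t) : 0 < S.kc t := by
  obtain ⟨b, hb, h⟩ := href.kc_lower
  exact hb.trans_le (h t ht)

theorem contDiff_refSignals (href : S.RefAssumptions ℓ) :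
    ContDiff ℝ 1 S.refSignals := by
  have h1 : ContDiff ℝ 1 (deriv S.qd) := (href.qd_smooth : ContDiff ℝ (1 + 1) S.qd).deriv'
  have h2 : ContDiff ℝ 1 (deriv S.kc) := (href.kc_smooth : ContDiff ℝ (1 + 1) S.kc).deriv'
  exact (href.qd_smooth.of_le one_le_two).prodMk (h1.prodMk
    ((href.kc_smooth.of_le one_le_two).prodMk (h2.prodMk
      ((contDiff_shift S.Tc).prodMk (contDiff_shiftRate S.Tc)))))

theorem contDiffAt_αRef (hβ : 0 < S.β) {p : RefSignals n × Vec n} (hk : p.1.2.2.1 ≠ 0)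
    (hgap : p.1.2.2.1 ^ 2 - ‖p.1.2.2.2.2.1 • (p.2 - p.1.1)‖ ^ 2 ≠ 0) :
    ContDiffAt ℝ 2 S.αRef p := by
  unfold αRef
  have he : ContDiffAt ℝ 2 (fun p : RefSignals n × Vec n => p.2 - p.1.1) p := by fun_prop
  have hg : ContDiffAt ℝ 2 (fun p : RefSignals n × Vec n =>
      S.β * (p.1.2.2.1 ^ 2 - ‖p.1.2.2.2.2.1 • (p.2 - p.1.1)‖ ^ 2)) p := by
    have : ContDiffAt ℝ 2 (fun p : RefSignals n × Vec n => p.1.2.2.2.2.1 • (p.2 - p.1.1)) p := by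
      fun_prop
    have := this.norm_sq ℝ
    fun_prop
  have hn := he.norm_sq ℝ
  have hg0 : S.β * (p.1.2.2.1 ^ 2 - ‖p.1.2.2.2.2.1 • (p.2 - p.1.1)‖ ^ 2) ≠ 0 :=
    mul_ne_zero hβ.ne' hgap
  have h1 : ContDiffAt ℝ 2 (fun p : RefSignals n × Vec n =>
      S.a * p.1.2.2.2.2.2 ^ 2 * ‖p.2 - p.1.1‖ ^ 2
        / (S.β * (p.1.2.2.1 ^ 2 - ‖p.1.2.2.2.2.1 • (p.2 - p.1.1)‖ ^ 2))) p :=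
    ContDiffAt.fun_div (by fun_prop) hg hg0
  have h2 : ContDiffAt ℝ 2 (fun p : RefSignals n × Vec n => p.1.2.2.2.1 / p.1.2.2.1) p :=
    ContDiffAt.fun_div (by fun_prop) (by fun_prop) hk
  fun_prop

theorem contDiffAt_αRef_refSignals (href : S.RefAssumptions ℓ) (hβ : 0 < S.β) {t : ℝ}
    (ht : 0 ≤ t) {q : Vec n} (hgap : 0 < S.gap t q) :
    ContDiffAt ℝ 2 S.αRef (S.refSignals t, q) :=
  contDiffAt_αRef hβ (href.kc_pos ht).ne' hgap.ne'

/-- Chain rule for the virtual control along a curve with a one-sided derivative. -/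
theorem hasDerivWithinAt_α (href : S.RefAssumptions ℓ) (hβ : 0 < S.β) {t : ℝ}
    (ht : 0 ≤ t) {x : ℝ → Vec n} {v : Vec n} {s : Set ℝ} (hx : HasDerivWithinAt x v s t)
    (hgap : 0 < S.gap t (x t)) :
    HasDerivWithinAt (fun r => S.α r (x r))
      (fderiv ℝ S.αRef (S.refSignals t, x t) (deriv S.refSignals t, v)) s t := by
  have h1 := ((contDiffAt_αRef_refSignals href hβ ht hgap).differentiableAt two_ne_zero).hasFDerivAt
  have h2 : HasDerivAt S.refSignals (deriv S.refSignals t) t :=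
    ((contDiff_refSignals href).differentiable one_ne_zero t).hasDerivAt
  exact h1.comp_hasDerivWithinAt (f := fun r => (S.refSignals r, x r)) t
    (h2.hasDerivWithinAt.prodMk hx)

theorem αDot_eq (href : S.RefAssumptions ℓ) (hβ : 0 < S.β) {t : ℝ}
    (ht : 0 ≤ t) {q : Vec n} (v : Vec n) (hgap : 0 < S.gap t q) :
    S.αDot t q v = fderiv ℝ S.αRef (S.refSignals t, q) (deriv S.refSignals t, v) := by
  have hx : HasDerivWithinAt (fun s : ℝ => q + (s - t) • v) v Set.univ t := by
    have := (((hasDerivAt_id t).sub_const t).smul_const v).const_add q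
    rw [hasDerivWithinAt_univ]
    simpa using this
  have h := hasDerivWithinAt_α href hβ ht hx (by simpa using hgap)
  rw [hasDerivWithinAt_univ] at h
  simpa [αDot] using h.deriv

theorem hasDerivWithinAt_α_αDot (href : S.RefAssumptions ℓ) (hβ : 0 < S.β) {t : ℝ}
    (ht : 0 ≤ t) {x : ℝ → Vec n} {v : Vec n} {s : Set ℝ} (hx : HasDerivWithinAt x v s t)
    (hgap : 0 < S.gap t (x t)) :
    HasDerivWithinAt (fun r => S.α r (x r)) (S.αDot t (x t) v) s t := by
  rw [αDot_eq href hβ ht v hgap]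
  exact hasDerivWithinAt_α href hβ ht hx hgap

theorem PlantAssumptions.exists_equiv (h : S.PlantAssumptions μ₁ μ₂) (q : Vec n) :
    ∃ e : Vec n ≃L[ℝ] Vec n, (e : Vec n →L[ℝ] Vec n) = S.M q := by
  have hinj : Function.Injective (S.M q : Vec n →ₗ[ℝ] Vec n) := by
    rw [← LinearMap.ker_eq_bot, LinearMap.ker_eq_bot']
    intro z hz
    have h1 := h.M_lower q z
    have hz' : S.M q z = 0 := hz
    rw [hz', inner_zero_right] at h1
    have h2 : ‖z‖ ^ 2 ≤ 0 := by
      by_contra! hc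
      nlinarith [mul_pos h.μ₁_pos hc]
    have h3 : ‖z‖ = 0 := by nlinarith [norm_nonneg z]
    exact norm_eq_zero.1 h3
  refine ⟨(LinearEquiv.ofInjectiveEndo _ hinj).toContinuousLinearEquiv, ?_⟩
  ext1 z
  rfl

theorem PlantAssumptions.M_inverse_apply (h : S.PlantAssumptions μ₁ μ₂) (q w : Vec n) :
    S.M q ((S.M q).inverse w) = w := by
  obtain ⟨e, he⟩ := h.exists_equiv q
  rw [← he, ContinuousLinearMap.inverse_equiv]
  simp

theorem PlantAssumptions.contDiff_M_inverse (h : S.PlantAssumptions μ₁ μ₂) :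
    ContDiff ℝ 1 (fun q => (S.M q).inverse) := by
  rw [contDiff_iff_contDiffAt]
  intro q
  obtain ⟨e, he⟩ := h.exists_equiv q
  have h1 : ContDiffAt ℝ 1 ContinuousLinearMap.inverse (S.M q) := he ▸ contDiffAt_map_inverse e
  exact h1.comp q h.M_smooth.contDiffAt

theorem PlantAssumptions.norm_le (h : S.PlantAssumptions μ₁ μ₂) (q z : Vec n) :
    ‖z‖ ≤ ‖S.M q z‖ / μ₁ := by
  rw [le_div_iff₀ h.μ₁_pos]
  have h1 := (h.M_lower q z).trans (real_inner_le_norm _ _)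
  rcases (norm_nonneg z).eq_or_lt with h0 | h0
  · rw [← h0, zero_mul]; positivity
  · nlinarith

theorem continuous_C (h : S.PlantAssumptions μ₁ μ₂) :
    Continuous (fun p : Vec n × Vec n => S.C p.1 p.2) :=
  h.C_lip.continuous

end ArmControl

namespace ArmControl

open Filter Topology

variable {n la lc : ℕ} {S : ArmControl n la lc}
variable {μ₁ μ₂ ℓ κ Sabar Scbar : ℝ}

theorem continuous_gap (href : S.RefAssumptions ℓ) :
    Continuous (fun p : ℝ × State n la lc => S.gap p.1 p.2.1) := by
  have h1 : Continuous S.kc := href.kc_smooth.continuous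
  have h2 : Continuous S.qd := href.qd_smooth.continuous
  have h3 : Continuous (shift S.Tc) := (contDiff_shift S.Tc).continuous
  unfold gap Zγ Z₁
  fun_prop

theorem continuousAt_α (href : S.RefAssumptions ℓ) (hβ : 0 < S.β)
    {p : ℝ × Vec n} (ht : 0 ≤ p.1) (hgap : 0 < S.gap p.1 p.2) :
    ContinuousAt (fun p : ℝ × Vec n => S.α p.1 p.2) p := by
  have h1 := (contDiffAt_αRef_refSignals href hβ ht hgap).continuousAt
  have h2 : ContinuousAt (fun p : ℝ × Vec n => (S.refSignals p.1, p.2)) p :=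
    ((contDiff_refSignals href).continuous.comp continuous_fst).prodMk continuous_snd
      |>.continuousAt
  exact ContinuousAt.comp (f := fun p : ℝ × Vec n => (S.refSignals p.1, p.2)) h1 h2

theorem continuousAt_V (hplant : S.PlantAssumptions μ₁ μ₂) (href : S.RefAssumptions ℓ)
    (hβ : 0 < S.β) (Wa : Fin n → Vec la) (Wc : Vec lc)
    {p : ℝ × State n la lc} (ht : 0 ≤ p.1) (hgap : 0 < S.gap p.1 p.2.1) :
    ContinuousAt (fun p : ℝ × State n la lc => S.V Wa Wc p.1 p.2) p := by
  have hproj : ContinuousAt (fun p : ℝ × State n la lc => (p.1, p.2.1)) p := by fun_prop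
  have hg : ContinuousAt (fun p : ℝ × State n la lc => S.gap p.1 p.2.1) p :=
    (continuous_gap href).continuousAt
  have hα : ContinuousAt (fun p : ℝ × State n la lc => S.α p.1 p.2.1) p :=
    ContinuousAt.comp (f := fun p : ℝ × State n la lc => (p.1, p.2.1))
      (continuousAt_α (p := (p.1, p.2.1)) href hβ ht hgap) hproj
  have hZ : ContinuousAt (fun p : ℝ × State n la lc => S.Z₂ p.1 p.2.1 p.2.2.1) p := by
    unfold Z₂; fun_prop
  have hM : ContinuousAt (fun p : ℝ × State n la lc => S.M p.2.1) p := by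
    have := hplant.M_smooth.continuous
    fun_prop
  have hkc : ContinuousAt (fun p : ℝ × State n la lc => S.kc p.1) p := by
    have := href.kc_smooth.continuous
    fun_prop
  have hlog : ContinuousAt
      (fun p : ℝ × State n la lc => Real.log (S.kc p.1 ^ 2 / S.gap p.1 p.2.1)) p :=
    ((hkc.pow 2).div hg hgap.ne').log
      (div_ne_zero (pow_ne_zero 2 (href.kc_pos ht).ne') hgap.ne')
  have hMZ : ContinuousAt (fun p : ℝ × State n la lc => ⟪S.Z₂ p.1 p.2.1 p.2.2.1,
      S.M p.2.1 (S.Z₂ p.1 p.2.1 p.2.2.1)⟫) p := hZ.inner (𝕜 := ℝ) (hM.clm_apply hZ)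
  unfold V V₁
  fun_prop

theorem contDiff_stack₂ {k : WithTop ℕ∞} :
    ContDiff ℝ k (fun p : Vec n × Vec n => (WithLp.toLp 2 ![p.1, p.2] : Stack 2 n)) := by
  refine PiLp.contDiff_toLp.comp (contDiff_pi.2 fun i => ?_)
  fin_cases i
  · exact contDiff_fst
  · exact contDiff_snd

theorem contDiff_stack₄ {k : WithTop ℕ∞} :
    ContDiff ℝ k (fun p : Vec n × Vec n × Vec n × Vec n =>
      (WithLp.toLp 2 ![p.1, p.2.1, p.2.2.1, p.2.2.2] : Stack 4 n)) := by
  refine PiLp.contDiff_toLp.comp (contDiff_pi.2 fun i => ?_)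
  fin_cases i
  · exact contDiff_fst
  · exact contDiff_fst.comp contDiff_snd
  · exact contDiff_fst.comp (contDiff_snd.comp contDiff_snd)
  · exact contDiff_snd.comp (contDiff_snd.comp contDiff_snd)

/-- The closed-loop field is Lipschitz in the state and right-continuous in time inside the
barrier. -/
theorem rightRegularAt_field (hplant : S.PlantAssumptions μ₁ μ₂) (href : S.RefAssumptions ℓ)
    (hβ : 0 < S.β) {t : ℝ} (ht : 0 ≤ t) {x : State n la lc}
    (hgap : 0 < S.gap t x.1) : RightRegularAt S.field t x := by
  have hq : RightRegularAt (fun (_ : ℝ) (x : State n la lc) => x.1) t x :=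
    RightRegularAt.id.comp_contDiffAt (Φ := fun x : State n la lc => x.1) (by fun_prop)
  have hv : RightRegularAt (fun (_ : ℝ) (x : State n la lc) => x.2.1) t x :=
    RightRegularAt.id.comp_contDiffAt (Φ := fun x : State n la lc => x.2.1) (by fun_prop)
  have hWa : RightRegularAt (fun (_ : ℝ) (x : State n la lc) => x.2.2.1) t x :=
    RightRegularAt.id.comp_contDiffAt (Φ := fun x : State n la lc => x.2.2.1) (by fun_prop)
  have hWc : RightRegularAt (fun (_ : ℝ) (x : State n la lc) => x.2.2.2) t x :=
    RightRegularAt.id.comp_contDiffAt (Φ := fun x : State n la lc => x.2.2.2) (by fun_prop)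
  have hrefC := contDiff_refSignals href
  have hθ : RightRegularAt (fun t (_ : State n la lc) => S.refSignals t) t x :=
    .of_continuous hrefC.continuous
  have hθ' : RightRegularAt (fun t (_ : State n la lc) => deriv S.refSignals t) t x :=
    .of_continuous (hrefC.continuous_deriv le_rfl)
  have hd : RightRegularAt (fun t (_ : State n la lc) => S.d t) t x :=
    .of_time (hplant.d_pw t ht)
  have hsm := contDiffAt_αRef_refSignals href hβ ht hgap
  have hα : RightRegularAt (fun t (x : State n la lc) => S.α t x.1) t x :=
    (hθ.prodMk hq).comp_contDiffAt (hsm.of_le one_le_two)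
  -- `α̇` is given by its chain-rule formula only inside the barrier
  have hαDot' : RightRegularAt (fun t (x : State n la lc) =>
      fderiv ℝ S.αRef (S.refSignals t, x.1) (deriv S.refSignals t, x.2.1)) t x := by
    refine ((hθ.prodMk hq).prodMk (hθ'.prodMk hv)).comp_contDiffAt
      (Φ := fun p : (RefSignals n × Vec n) × (RefSignals n × Vec n) =>
        fderiv ℝ S.αRef p.1 p.2) ?_
    have h1 : ContDiffAt ℝ 1 (fderiv ℝ S.αRef) (S.refSignals t, x.1) :=
      hsm.fderiv_right (by norm_num)
    exact (h1.comp (((S.refSignals t, x.1), (deriv S.refSignals t, x.2.1)) :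
      (RefSignals n × Vec n) × (RefSignals n × Vec n)) contDiffAt_fst).clm_apply contDiffAt_snd
  have hαDot : RightRegularAt (fun t (x : State n la lc) => S.αDot t x.1 x.2.1) t x := by
    refine hαDot'.congr ?_
    have hg : ContinuousAt (fun p : ℝ × State n la lc => S.gap p.1 p.2.1) (t, x) :=
      (continuous_gap href).continuousAt
    filter_upwards [hg.eventually (lt_mem_nhds hgap)] with p hp hp0
    exact αDot_eq href hβ (ht.trans hp0) _ hp
  have hqd' : RightRegularAt (fun t (_ : State n la lc) => deriv S.qd t) t x :=
    .of_continuous (href.qd_smooth.continuous_deriv one_le_two)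
  have hZ₁ : RightRegularAt (fun t (x : State n la lc) => S.Z₁ t x.1) t x :=
    hq.sub (.of_continuous href.qd_smooth.continuous)
  have hZ₂ : RightRegularAt (fun t (x : State n la lc) => S.Z₂ t x.1 x.2.1) t x := hv.sub hα
  have hZc : RightRegularAt (fun t (x : State n la lc) => S.Zc t x.1 x.2.1) t x :=
    (hZ₁.prodMk hZ₂).comp_contDiffAt contDiff_stack₂.contDiffAt
  have hZa : RightRegularAt (fun t (x : State n la lc) => S.Za t x.1 x.2.1) t x :=
    (hq.prodMk (hv.prodMk (hZ₁.prodMk hZ₂))).comp_contDiffAt contDiff_stack₄.contDiffAt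
  have hSa : RightRegularAt (fun t (x : State n la lc) => S.Sa (S.Za t x.1 x.2.1)) t x :=
    hZa.comp_contDiffAt (contDiff_rbf _ _ 1).contDiffAt
  have hSc : RightRegularAt (fun t (x : State n la lc) => S.Sc (S.Zc t x.1 x.2.1)) t x :=
    hZc.comp_contDiffAt (contDiff_rbf _ _ 1).contDiffAt
  have hact : RightRegularAt (fun t (x : State n la lc) => S.actorOut t x.1 x.2.1 x.2.2.1) t x := by
    refine (hWa.prodMk hSa).comp_contDiffAt
      (Φ := fun p : (Fin n → Vec la) × Vec la =>
        (WithLp.toLp 2 (fun i => ⟪p.1 i, p.2⟫) : Vec n)) ?_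
    refine ContDiff.contDiffAt (PiLp.contDiff_toLp.comp (contDiff_pi.2 fun i => ?_))
    exact ContDiff.inner ℝ (by fun_prop) (by fun_prop)
  have hbar : RightRegularAt (fun t (x : State n la lc) =>
      (shift S.Tc t / (S.β * S.gap t x.1)) • S.Zγ t x.1) t x := by
    refine (hθ.prodMk hq).comp_contDiffAt
      (Φ := fun p : RefSignals n × Vec n => (p.1.2.2.2.2.1 /
        (S.β * (p.1.2.2.1 ^ 2 - ‖p.1.2.2.2.2.1 • (p.2 - p.1.1)‖ ^ 2))) •
          (p.1.2.2.2.2.1 • (p.2 - p.1.1))) ?_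
    have h1 : ContDiff ℝ 1
        (fun p : RefSignals n × Vec n => p.1.2.2.2.2.1 • (p.2 - p.1.1)) := by fun_prop
    have h2 := h1.norm_sq ℝ
    have h3 : ContDiffAt ℝ 1 (fun p : RefSignals n × Vec n => p.1.2.2.2.2.1 /
        (S.β * (p.1.2.2.1 ^ 2 - ‖p.1.2.2.2.2.1 • (p.2 - p.1.1)‖ ^ 2))) (S.refSignals t, x.1) :=
      ContDiffAt.fun_div (by fun_prop) (by fun_prop) (mul_ne_zero hβ.ne' hgap.ne')
    fun_prop
  have hτ : RightRegularAt S.τ t x :=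
    (hact.sub (hZ₂.comp_contDiffAt S.K₂.contDiff.contDiffAt)).sub hbar
  have hacc : RightRegularAt S.accel t x := by
    have hC : RightRegularAt (fun (_ : ℝ) (x : State n la lc) => S.C x.1 x.2.1) t x :=
      (hq.prodMk hv).comp (hplant.C_lip (x.1, x.2.1))
    have hCv : RightRegularAt (fun (_ : ℝ) (x : State n la lc) => S.C x.1 x.2.1 x.2.1) t x :=
      (hC.prodMk hv).comp_contDiffAt
        (Φ := fun p : (Vec n →L[ℝ] Vec n) × Vec n => p.1 p.2) (by fun_prop)
    have hG : RightRegularAt (fun (_ : ℝ) (x : State n la lc) => S.G x.1) t x :=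
      hq.comp (hplant.G_lip x.1)
    have hM : RightRegularAt (fun (_ : ℝ) (x : State n la lc) => (S.M x.1).inverse) t x :=
      hq.comp_contDiffAt hplant.contDiff_M_inverse.contDiffAt
    exact (hM.prodMk (((hτ.add hd).sub hCv).sub hG)).comp_contDiffAt
      (Φ := fun p : (Vec n →L[ℝ] Vec n) × Vec n => p.1 p.2) (by fun_prop)
  have hJ : RightRegularAt S.Jhat t x :=
    (hWc.prodMk hSc).comp_contDiffAt (Φ := fun p : Vec lc × Vec lc => ⟪p.1, p.2⟫)
      (ContDiffAt.inner ℝ contDiffAt_fst contDiffAt_snd)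
  have hcost : RightRegularAt S.cost t x := by
    have h1 : ContDiff ℝ 1 (fun z : Stack 2 n => ⟪z, S.Q z⟫) :=
      contDiff_id.inner ℝ S.Q.contDiff
    have h2 : ContDiff ℝ 1 (fun z : Vec n => ⟪z, S.R z⟫) := contDiff_id.inner ℝ S.R.contDiff
    exact (hZc.comp_contDiffAt h1.contDiffAt).add (hτ.comp_contDiffAt h2.contDiffAt)
  have hZcDot : RightRegularAt S.ZcDot t x :=
    ((hv.sub hqd').prodMk (hacc.sub hαDot)).comp_contDiffAt contDiff_stack₂.contDiffAt
  have hΛ : RightRegularAt S.Λ t x := by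
    have h1 : ContDiff ℝ 1 (fderiv ℝ S.Sc) :=
      (contDiff_rbf S.criticCenter S.criticWidth 2).fderiv_right (by norm_num)
    have h2 : RightRegularAt (fun t x => fderiv ℝ S.Sc (S.Zc t x.1 x.2.1) (S.ZcDot t x)) t x :=
      ((hZc.comp_contDiffAt h1.contDiffAt).prodMk hZcDot).comp_contDiffAt
        (Φ := fun p : (Stack 2 n →L[ℝ] Vec lc) × Stack 2 n => p.1 p.2) (by fun_prop)
    exact (hSc.comp_contDiffAt (Φ := fun s : Vec lc => -((1 / S.ψ) • s)) (by fun_prop)).add h2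
  have htd : RightRegularAt (fun t (x : State n la lc) => S.tdError t x x.2.2.2) t x :=
    hcost.add ((hWc.prodMk hΛ).comp_contDiffAt (Φ := fun p : Vec lc × Vec lc => ⟪p.1, p.2⟫)
      (ContDiffAt.inner ℝ contDiffAt_fst contDiffAt_snd))
  have hcr : RightRegularAt S.criticRate t x :=
    ((htd.prodMk hΛ).comp_contDiffAt
      (Φ := fun p : ℝ × Vec lc => -((S.σc * p.1) • p.2)) (by fun_prop)).sub
    (hWc.comp_contDiffAt (Φ := fun w : Vec lc => (S.σc * S.ηc) • w) (by fun_prop))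
  have har : RightRegularAt S.actorRate t x := by
    refine ((hact.prodMk (hZ₂.prodMk hJ)).prodMk (hSa.prodMk hWa)).comp_contDiffAt
      (Φ := fun p : (Vec n × Vec n × ℝ) × Vec la × (Fin n → Vec la) => fun i : Fin n =>
        -((S.σa * (p.1.1 i + p.1.2.1 i / S.σa + S.ka * p.1.2.2)) • p.2.1)
          - (S.σa * S.ηa) • p.2.2 i) ?_
    refine ContDiff.contDiffAt (contDiff_pi.2 fun i => ?_)
    fun_prop
  exact hv.prodMk (hacc.prodMk (har.prodMk hcr))

end ArmControl

/-! ### The Lyapunov inequality -/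

namespace ArmControl

open Filter Topology

variable {n la lc : ℕ} {S : ArmControl n la lc}
variable {μ₁ μ₂ ℓ κ Sabar Scbar : ℝ}

/-- In the barrier part of the Lyapunov function, the second term of `α` absorbs the transient
`γ γ̇ ‖Z₁‖²` at the cost of `1 / (4 a)`, and the term `k̇_c / k_c` cancels the drift of the bound. -/
theorem hasDerivWithinAt_V₁ (href : S.RefAssumptions ℓ) (hgain : S.GainAssumptions κ Sabar Scbar)
    {t : ℝ} (ht : 0 ≤ t) {x : ℝ → Vec n} {v : Vec n} {s : Set ℝ} (hx : HasDerivWithinAt x v s t)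
    (hgap : 0 < S.gap t (x t)) :
    ∃ D, HasDerivWithinAt (fun r => S.V₁ r (x r)) D s t ∧
      D ≤ 1 / (4 * S.a) - 2 * S.K₁ * S.V₁ t (x t)
        + shift S.Tc t / (S.β * S.gap t (x t)) * ⟪S.Z₂ t (x t) v, S.Zγ t (x t)⟫ := by
  have hβ := hgain.β_pos
  have ha := hgain.a_pos
  have hk := href.kc_pos ht
  have hqd : HasDerivWithinAt S.qd (deriv S.qd t) s t :=
    ((href.qd_smooth.differentiable two_ne_zero) t).hasDerivAt.hasDerivWithinAt
  have hkc : HasDerivWithinAt S.kc (deriv S.kc t) s t :=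
    ((href.kc_smooth.differentiable two_ne_zero) t).hasDerivAt.hasDerivWithinAt
  have hγ := (hasDerivAt_shift S.Tc t).hasDerivWithinAt (s := s)
  have hZγ : HasDerivWithinAt (fun r => S.Zγ r (x r))
      (shift S.Tc t • (v - deriv S.qd t) + shiftRate S.Tc t • S.Z₁ t (x t)) s t :=
    hγ.smul (hx.sub hqd)
  have hg : HasDerivWithinAt (fun r => S.gap r (x r))
      (2 * S.kc t * deriv S.kc t - 2 * ⟪S.Zγ t (x t),
        shift S.Tc t • (v - deriv S.qd t) + shiftRate S.Tc t • S.Z₁ t (x t)⟫) s t := by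
    refine ((hkc.pow 2).sub hZγ.norm_sq).congr_deriv ?_
    push_cast
    ring
  have hq0 : S.kc t ^ 2 / S.gap t (x t) ≠ 0 := by positivity
  have hV := (((hkc.pow 2).div hg hgap.ne').log hq0).const_mul (1 / (2 * S.β))
  set I : ℝ := ⟪S.Zγ t (x t),
    shift S.Tc t • (v - deriv S.qd t) + shiftRate S.Tc t • S.Z₁ t (x t)⟫ with hI
  refine ⟨(I - deriv S.kc t / S.kc t * ‖S.Zγ t (x t)‖ ^ 2) / (S.β * S.gap t (x t)),
    hV.congr_deriv ?_, ?_⟩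
  · have hk2 : ‖S.Zγ t (x t)‖ ^ 2 = S.kc t ^ 2 - S.gap t (x t) := by rw [gap]; ring
    rw [hk2]
    simp only [Pi.pow_apply, Pi.div_apply]
    have := hk.ne'
    field_simp
    push_cast
    ring
  -- the closed-loop expression of `q̇ - q̇_d`
  have hv : v - deriv S.qd t = S.Z₂ t (x t) v - S.K₁ • S.Z₁ t (x t)
      - (S.a * shiftRate S.Tc t ^ 2 * ‖S.Z₁ t (x t)‖ ^ 2 / (S.β * S.gap t (x t))) • S.Z₁ t (x t)
      + (deriv S.kc t / S.kc t) • S.Z₁ t (x t) := by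
    simp only [Z₂, α]; abel
  have hlog : S.V₁ t (x t) ≤ ‖S.Zγ t (x t)‖ ^ 2 / (2 * S.β * S.gap t (x t)) := by
    have h1 := Real.log_le_sub_one_of_pos (x := S.kc t ^ 2 / S.gap t (x t)) (by positivity)
    have h2 : S.kc t ^ 2 / S.gap t (x t) - 1 = ‖S.Zγ t (x t)‖ ^ 2 / S.gap t (x t) := by
      rw [div_sub_one hgap.ne']; congr 1; rw [gap]; ring
    rw [h2] at h1
    calc S.V₁ t (x t) ≤ 1 / (2 * S.β) * (‖S.Zγ t (x t)‖ ^ 2 / S.gap t (x t)) := by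
          unfold V₁; gcongr
      _ = _ := by field_simp
  have hZZ : S.Zγ t (x t) = shift S.Tc t • S.Z₁ t (x t) := rfl
  have hK : 0 < S.K₁ := by linarith [hgain.K₁_gt]
  have hn : ‖S.Zγ t (x t)‖ ^ 2 = (shift S.Tc t) ^ 2 * ‖S.Z₁ t (x t)‖ ^ 2 := by
    rw [hZZ, norm_smul, mul_pow, Real.norm_eq_abs, sq_abs]
  rw [hn] at hlog ⊢
  rw [hI, hv, hZZ]
  simp only [inner_smul_left, inner_smul_right, inner_add_right, inner_sub_right,
    real_inner_self_eq_norm_sq, RCLike.conj_to_real]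
  rw [real_inner_comm (S.Z₂ t (x t) v)]
  generalize ⟪S.Z₂ t (x t) v, S.Z₁ t (x t)⟫ = P at *
  generalize S.V₁ t (x t) = V₁ at *
  generalize ‖S.Z₁ t (x t)‖ ^ 2 = N at *
  generalize S.gap t (x t) = g at *
  generalize shift S.Tc t = γ at *
  generalize shiftRate S.Tc t = γ' at *
  generalize S.kc t = k at *
  generalize deriv S.kc t = k' at *
  have key : γ * γ' * N / (S.β * g) - S.a * (γ * γ' * N / (S.β * g)) ^ 2 ≤ 1 / (4 * S.a) := by
    have h1 : 0 ≤ S.a * (γ * γ' * N / (S.β * g) - 1 / (2 * S.a)) ^ 2 := by positivity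
    have h2 : S.a * (γ * γ' * N / (S.β * g) - 1 / (2 * S.a)) ^ 2
        = S.a * (γ * γ' * N / (S.β * g)) ^ 2 - γ * γ' * N / (S.β * g) + 1 / (4 * S.a) := by
      field_simp; ring
    linarith
  have hlog' := mul_le_mul_of_nonneg_left hlog (by positivity : 0 ≤ 2 * S.K₁)
  have hid : 2 * S.K₁ * (γ ^ 2 * N / (2 * S.β * g)) = S.K₁ * γ ^ 2 * N / (S.β * g) := by
    field_simp
  rw [hid] at hlog'
  generalize k' / k = ρ at *
  refine le_trans (le_of_eq ?_) (add_le_add_left (sub_le_sub key hlog') _)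
  have := hgap.ne'
  field_simp
  ring

/-- The power balance of the manipulator in the error `Z₂`: by skew-symmetry of `Ṁ - 2C` the
kinetic part of the Lyapunov function changes at the rate `⟪Z₂, τ - f⟫`. -/
theorem hasDerivWithinAt_kinetic (hplant : S.PlantAssumptions μ₁ μ₂) (href : S.RefAssumptions ℓ)
    (hβ : 0 < S.β) {t : ℝ} (ht : 0 ≤ t) {x : ℝ → State n la lc} {s : Set ℝ}
    (hq : HasDerivWithinAt (fun r => (x r).1) (x t).2.1 s t)
    (hv : HasDerivWithinAt (fun r => (x r).2.1) (S.accel t (x t)) s t)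
    (hgap : 0 < S.gap t (x t).1) :
    HasDerivWithinAt (fun r => 1 / 2 * ⟪S.Z₂ r (x r).1 (x r).2.1,
      S.M (x r).1 (S.Z₂ r (x r).1 (x r).2.1)⟫)
      ⟪S.Z₂ t (x t).1 (x t).2.1, S.τ t (x t) - S.f t (x t)⟫ s t := by
  have hZ : HasDerivWithinAt (fun r => S.Z₂ r (x r).1 (x r).2.1)
      (S.accel t (x t) - S.αDot t (x t).1 (x t).2.1) s t :=
    hv.sub (hasDerivWithinAt_α_αDot href hβ ht hq hgap)
  have hM : HasDerivWithinAt (fun r => S.M (x r).1) (fderiv ℝ S.M (x t).1 (x t).2.1) s t :=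
    ((hplant.M_smooth.differentiable one_ne_zero) (x t).1).hasFDerivAt.comp_hasDerivWithinAt t hq
  refine ((hZ.inner ℝ (hM.clm_apply hZ)).const_mul (1 / 2)).congr_deriv ?_
  have hsk := hplant.skew (x t).1 (x t).2.1 (S.Z₂ t (x t).1 (x t).2.1)
  have hacc : S.M (x t).1 (S.accel t (x t))
      = S.τ t (x t) + S.d t - S.C (x t).1 (x t).2.1 (x t).2.1 - S.G (x t).1 :=
    hplant.M_inverse_apply _ _
  have hC : S.C (x t).1 (x t).2.1 (x t).2.1 = S.C (x t).1 (x t).2.1 (S.Z₂ t (x t).1 (x t).2.1)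
      + S.C (x t).1 (x t).2.1 (S.α t (x t).1) := by
    rw [← map_add, Z₂, sub_add_cancel]
  rw [← hplant.M_symm, real_inner_comm (S.Z₂ t (x t).1 (x t).2.1), map_sub, hacc, hC, f]
  simp only [sub_apply, smul_apply] at hsk
  simp only [inner_add_right, inner_sub_right, inner_smul_right] at hsk ⊢
  linarith

theorem inner_actorOut_sub (t : ℝ) (q v z : Vec n) (W W' : Fin n → Vec la) :
    ⟪z, S.actorOut t q v W - S.actorOut t q v W'⟫
      = ∑ i, z i * ⟪W i - W' i, S.Sa (S.Za t q v)⟫ := by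
  simp [PiLp.inner_apply, actorOut, inner_sub_left, mul_comm]

theorem GainAssumptions.Scbar_nonneg (hgain : S.GainAssumptions κ Sabar Scbar) : 0 ≤ Scbar :=
  (sq_nonneg _).trans (hgain.Sc_le 0)

theorem GainAssumptions.Sabar_nonneg (hgain : S.GainAssumptions κ Sabar Scbar) : 0 ≤ Sabar :=
  (sq_nonneg _).trans (hgain.Sa_le 0)

theorem inner_τ_sub_f_le (hgain : S.GainAssumptions κ Sabar Scbar) (Wa : Fin n → Vec la) {εa : ℝ}
    (t : ℝ) (x : State n la lc) (hε : ‖S.f t x - S.actorOut t x.1 x.2.1 Wa‖ ≤ εa) :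
    ⟪S.Z₂ t x.1 x.2.1, S.τ t x - S.f t x⟫ ≤
      ∑ i, S.Z₂ t x.1 x.2.1 i * ⟪x.2.2.1 i - Wa i, S.Sa (S.Za t x.1 x.2.1)⟫ + 1 / 2 * εa ^ 2
        - κ * ‖S.Z₂ t x.1 x.2.1‖ ^ 2
        - shift S.Tc t / (S.β * S.gap t x.1) * ⟪S.Z₂ t x.1 x.2.1, S.Zγ t x.1⟫ := by
  rw [← inner_actorOut_sub, τ]
  have h1 := hgain.K₂_lower (S.Z₂ t x.1 x.2.1)
  have h2 : -⟪S.Z₂ t x.1 x.2.1, S.f t x - S.actorOut t x.1 x.2.1 Wa⟫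
      ≤ 1 / 2 * ‖S.Z₂ t x.1 x.2.1‖ ^ 2 + 1 / 2 * εa ^ 2 := by
    have h3 := (neg_le_abs _).trans
      (abs_real_inner_le_norm (S.Z₂ t x.1 x.2.1) (S.f t x - S.actorOut t x.1 x.2.1 Wa))
    nlinarith [norm_nonneg (S.Z₂ t x.1 x.2.1), sq_nonneg (‖S.Z₂ t x.1 x.2.1‖ - εa)]
  simp only [inner_sub_right, inner_smul_right] at *
  linarith

theorem critic_power_le (hgain : S.GainAssumptions κ Sabar Scbar) (Wc : Vec lc) {ec : ℝ}
    (t : ℝ) (x : State n la lc) (he : |S.tdError t x Wc| ≤ ec) :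
    1 / S.σc * ⟪x.2.2.2 - Wc, S.criticRate t x⟫ ≤
      1 / 4 * ec ^ 2 - S.ηc / 2 * ‖x.2.2.2 - Wc‖ ^ 2 + S.ηc / 2 * ‖Wc‖ ^ 2 := by
  have hσ := hgain.σc_pos
  have hη := hgain.ηc_pos
  obtain ⟨w, hw⟩ : ∃ w, x.2.2.2 = w + Wc := ⟨x.2.2.2 - Wc, by abel⟩
  have htd : S.tdError t x x.2.2.2 = S.tdError t x Wc + ⟪w, S.Λ t x⟫ := by
    rw [tdError, tdError, hw, inner_add_left]; ring
  have he2 : S.tdError t x Wc ^ 2 ≤ ec ^ 2 := by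
    rw [← sq_abs]; gcongr
  rw [criticRate, htd, hw, add_sub_cancel_right]
  simp only [inner_sub_right, inner_neg_right, inner_smul_right, inner_add_right,
    real_inner_self_eq_norm_sq]
  have h1 : -⟪w, Wc⟫ ≤ 1 / 2 * ‖w‖ ^ 2 + 1 / 2 * ‖Wc‖ ^ 2 := by
    have := norm_add_sq_real w Wc
    nlinarith [sq_nonneg ‖w + Wc‖]
  have h2 := mul_le_mul_of_nonneg_left h1 hη.le
  have h3 : 1 / S.σc * (-(S.σc * (S.tdError t x Wc + ⟪w, S.Λ t x⟫) * ⟪w, S.Λ t x⟫)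
      - S.σc * S.ηc * (‖w‖ ^ 2 + ⟪w, Wc⟫)) = -((S.tdError t x Wc + ⟪w, S.Λ t x⟫) * ⟪w, S.Λ t x⟫)
      - S.ηc * (‖w‖ ^ 2 + ⟪w, Wc⟫) := by
    field_simp
  rw [h3]
  nlinarith [sq_nonneg (S.tdError t x Wc + 2 * ⟪w, S.Λ t x⟫)]

theorem actor_power_le (hgain : S.GainAssumptions κ Sabar Scbar) (Wa : Fin n → Vec la)
    (Wc : Vec lc) (t : ℝ) (x : State n la lc) :
    ∑ i, ⟪x.2.2.1 i - Wa i, S.actorRate t x i⟫ ≤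
      -∑ i, S.Z₂ t x.1 x.2.1 i * ⟪x.2.2.1 i - Wa i, S.Sa (S.Za t x.1 x.2.1)⟫
        + S.σa / 2 * (S.ηa + Sabar) * ∑ i, ‖Wa i‖ ^ 2
        + n * S.σa * S.ka ^ 2 * Scbar * (‖x.2.2.2 - Wc‖ ^ 2 + ‖Wc‖ ^ 2)
        - S.σa * S.ηa / 2 * ∑ i, ‖x.2.2.1 i - Wa i‖ ^ 2 := by
  have hσ := hgain.σa_pos
  have hη := hgain.ηa_pos
  have hJ : S.Jhat t x ^ 2 ≤ 2 * Scbar * (‖x.2.2.2 - Wc‖ ^ 2 + ‖Wc‖ ^ 2) := by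
    have h1 : S.Jhat t x ^ 2 ≤ ‖x.2.2.2‖ ^ 2 * ‖S.Sc (S.Zc t x.1 x.2.1)‖ ^ 2 := by
      rw [← mul_pow, ← sq_abs]
      gcongr
      exact abs_real_inner_le_norm _ _
    have h2 : ‖x.2.2.2‖ ^ 2 ≤ 2 * (‖x.2.2.2 - Wc‖ ^ 2 + ‖Wc‖ ^ 2) := by
      have h3 : ‖x.2.2.2‖ ≤ ‖x.2.2.2 - Wc‖ + ‖Wc‖ := by
        simpa using norm_add_le (x.2.2.2 - Wc) Wc
      nlinarith [norm_nonneg x.2.2.2, sq_nonneg (‖x.2.2.2 - Wc‖ - ‖Wc‖)]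
    have h4 := mul_le_mul h2 (hgain.Sc_le (S.Zc t x.1 x.2.1)) (sq_nonneg _) (by positivity)
    linarith
  have hi : ∀ i, ⟪x.2.2.1 i - Wa i, S.actorRate t x i⟫ ≤
      -(S.Z₂ t x.1 x.2.1 i * ⟪x.2.2.1 i - Wa i, S.Sa (S.Za t x.1 x.2.1)⟫)
        + S.σa / 2 * (S.ηa + Sabar) * ‖Wa i‖ ^ 2
        + S.σa * S.ka ^ 2 * Scbar * (‖x.2.2.2 - Wc‖ ^ 2 + ‖Wc‖ ^ 2)
        - S.σa * S.ηa / 2 * ‖x.2.2.1 i - Wa i‖ ^ 2 := by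
    intro i
    obtain ⟨w, hw⟩ : ∃ w, x.2.2.1 i = w + Wa i := ⟨x.2.2.1 i - Wa i, by abel⟩
    have hout : S.actorOut t x.1 x.2.1 x.2.2.1 i = ⟪w, S.Sa (S.Za t x.1 x.2.1)⟫
        + ⟪Wa i, S.Sa (S.Za t x.1 x.2.1)⟫ := by
      rw [← inner_add_left, ← hw]; rfl
    have hu : ⟪Wa i, S.Sa (S.Za t x.1 x.2.1)⟫ ^ 2 ≤ Sabar * ‖Wa i‖ ^ 2 := by
      have h1 : ⟪Wa i, S.Sa (S.Za t x.1 x.2.1)⟫ ^ 2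
          ≤ ‖Wa i‖ ^ 2 * ‖S.Sa (S.Za t x.1 x.2.1)‖ ^ 2 := by
        rw [← mul_pow, ← sq_abs]
        gcongr
        exact abs_real_inner_le_norm _ _
      have h2 := mul_le_mul_of_nonneg_left (hgain.Sa_le (S.Za t x.1 x.2.1)) (sq_nonneg ‖Wa i‖)
      linarith
    have hww : -⟪w, Wa i⟫ ≤ 1 / 2 * ‖w‖ ^ 2 + 1 / 2 * ‖Wa i‖ ^ 2 := by
      have := norm_add_sq_real w (Wa i)
      nlinarith [sq_nonneg ‖w + Wa i‖]
    rw [actorRate, hout, hw, add_sub_cancel_right]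
    simp only [inner_sub_right, inner_neg_right, inner_smul_right, inner_add_right,
      real_inner_self_eq_norm_sq]
    generalize ⟪w, S.Sa (S.Za t x.1 x.2.1)⟫ = p at *
    generalize ⟪Wa i, S.Sa (S.Za t x.1 x.2.1)⟫ = u at *
    generalize S.Jhat t x = J at *
    generalize S.Z₂ t x.1 x.2.1 i = z at *
    have h1 := mul_le_mul_of_nonneg_left hww (mul_pos hσ hη).le
    have h2 := mul_le_mul_of_nonneg_left hu (half_pos hσ).le
    have h3 := mul_le_mul_of_nonneg_left hJ (by positivity : 0 ≤ S.σa / 2 * S.ka ^ 2)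
    have h4 : 0 ≤ S.σa / 2 * ((p + u) ^ 2 + (p + S.ka * J) ^ 2) := by positivity
    have h5 : S.σa * (p + u + z / S.σa + S.ka * J) * p
        = S.σa * (p + u + S.ka * J) * p + z * p := by field_simp; ring
    rw [h5]
    linarith
  refine (Finset.sum_le_sum fun i _ => hi i).trans (le_of_eq ?_)
  simp only [Finset.sum_add_distrib, Finset.sum_sub_distrib, Finset.sum_neg_distrib,
    ← Finset.mul_sum, Finset.sum_const, Finset.card_univ, Fintype.card_fin, nsmul_eq_mul]
  ring

theorem V₁_nonneg (hβ : 0 < S.β) {t : ℝ} {q : Vec n} (hgap : 0 < S.gap t q) : 0 ≤ S.V₁ t q := by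
  refine mul_nonneg (by positivity) (Real.log_nonneg ?_)
  rw [one_le_div hgap, gap]
  linarith [sq_nonneg ‖S.Zγ t q‖]

theorem ι₁_pos (hplant : S.PlantAssumptions μ₁ μ₂) (hgain : S.GainAssumptions κ Sabar Scbar) :
    0 < S.ι₁ μ₂ κ Scbar := by
  have h1 := hgain.K₁_gt
  have h2 := hgain.κ_pos
  have h3 := hplant.μ₂_pos
  have h4 := hgain.ηc_gt
  have h5 := hgain.σc_pos
  have h6 := hgain.σa_pos
  have h7 := hgain.ηa_pos
  exact lt_min (lt_min (by linarith) (by positivity))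
    (lt_min (mul_pos h5 (by linarith)) (by positivity))

theorem ι₂_pos (hgain : S.GainAssumptions κ Sabar Scbar) (Wa : Fin n → Vec la) (Wc : Vec lc)
    (εa ec : ℝ) : 0 < S.ι₂ Sabar Scbar Wa Wc εa ec := by
  have h1 := hgain.Sabar_nonneg
  have h2 := hgain.Scbar_nonneg
  have h4 := hgain.ηc_pos
  have h5 := hgain.a_pos
  have h6 := hgain.σa_pos
  have h7 := hgain.ηa_pos
  unfold ι₂
  positivity

/-- The Lyapunov inequality `V̇ ≤ -ι₁ V + ι₂` at every point where the networks approximate. -/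
theorem hasDerivWithinAt_V (hplant : S.PlantAssumptions μ₁ μ₂) (href : S.RefAssumptions ℓ)
    (hgain : S.GainAssumptions κ Sabar Scbar) {Wa : Fin n → Vec la} {Wc : Vec lc} {εa ec : ℝ}
    {t : ℝ} (ht : 0 ≤ t) {x : ℝ → State n la lc} {s : Set ℝ}
    (hx : HasDerivWithinAt x (S.field t (x t)) s t) (hgap : 0 < S.gap t (x t).1)
    (hε : ‖S.f t (x t) - S.actorOut t (x t).1 (x t).2.1 Wa‖ ≤ εa)
    (he : |S.tdError t (x t) Wc| ≤ ec) :
    ∃ D, HasDerivWithinAt (fun r => S.V Wa Wc r (x r)) D s t ∧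
      D ≤ -S.ι₁ μ₂ κ Scbar * S.V Wa Wc t (x t) + S.ι₂ Sabar Scbar Wa Wc εa ec := by
  have hq : HasDerivWithinAt (fun r => (x r).1) (x t).2.1 s t := hx.fst
  have hv : HasDerivWithinAt (fun r => (x r).2.1) (S.accel t (x t)) s t := hx.snd.fst
  have hwa : HasDerivWithinAt (fun r => (x r).2.2.1) (S.actorRate t (x t)) s t := hx.snd.snd.fst
  have hwc : HasDerivWithinAt (fun r => (x r).2.2.2) (S.criticRate t (x t)) s t := hx.snd.snd.snd
  obtain ⟨D₁, hD₁, hD₁le⟩ := hasDerivWithinAt_V₁ href hgain ht hq hgap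
  have hD₂ := hasDerivWithinAt_kinetic hplant href hgain.β_pos ht hq hv hgap
  have hD₃ := (hwc.sub_const Wc).norm_sq.const_mul (1 / (2 * S.σc))
  have hD₄ := (HasDerivWithinAt.fun_sum (u := Finset.univ) fun i _ =>
    ((hasDerivWithinAt_pi.1 hwa i).sub_const (Wa i)).norm_sq).const_mul (1 / 2)
  refine ⟨_, ((hD₁.add hD₂).add hD₃).add hD₄, ?_⟩
  have h2 := inner_τ_sub_f_le hgain Wa t (x t) hε
  have h3 := critic_power_le hgain Wc t (x t) he
  have h4 := actor_power_le hgain Wa Wc t (x t)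
  have hσc := hgain.σc_pos
  have e3 : 1 / (2 * S.σc) * (2 * ⟪(x t).2.2.2 - Wc, S.criticRate t (x t)⟫)
      = 1 / S.σc * ⟪(x t).2.2.2 - Wc, S.criticRate t (x t)⟫ := by field_simp
  rw [e3, ← Finset.mul_sum]
  -- each part of `V` decays at least at the rate `ι₁`
  have i1 : S.ι₁ μ₂ κ Scbar ≤ S.K₁ := (min_le_left _ _).trans (min_le_left _ _)
  have i2 : S.ι₁ μ₂ κ Scbar ≤ 2 * κ / μ₂ := (min_le_left _ _).trans (min_le_right _ _)
  have i3 : S.ι₁ μ₂ κ Scbar ≤ S.σc * (S.ηc - 2 * n * S.σa * S.ka ^ 2 * Scbar) :=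
    (min_le_right _ _).trans (min_le_left _ _)
  have i4 : S.ι₁ μ₂ κ Scbar ≤ S.σa * S.ηa := (min_le_right _ _).trans (min_le_right _ _)
  have hι := ι₁_pos hplant hgain
  have hV₁ := V₁_nonneg hgain.β_pos hgap
  have hμ := hplant.μ₂_pos
  have j1 : S.ι₁ μ₂ κ Scbar * S.V₁ t (x t).1 ≤ 2 * S.K₁ * S.V₁ t (x t).1 := by
    gcongr; linarith [hgain.K₁_gt]
  have j2 : S.ι₁ μ₂ κ Scbar * (1 / 2 * ⟪S.Z₂ t (x t).1 (x t).2.1,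
      S.M (x t).1 (S.Z₂ t (x t).1 (x t).2.1)⟫) ≤ κ * ‖S.Z₂ t (x t).1 (x t).2.1‖ ^ 2 := by
    calc _ ≤ S.ι₁ μ₂ κ Scbar * (1 / 2 * (μ₂ * ‖S.Z₂ t (x t).1 (x t).2.1‖ ^ 2)) := by
          gcongr; exact hplant.M_upper _ _
      _ ≤ 2 * κ / μ₂ * (1 / 2 * (μ₂ * ‖S.Z₂ t (x t).1 (x t).2.1‖ ^ 2)) := by gcongr
      _ = _ := by field_simp
  have j3 : S.ι₁ μ₂ κ Scbar * (1 / (2 * S.σc) * ‖(x t).2.2.2 - Wc‖ ^ 2)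
      ≤ (S.ηc - 2 * n * S.σa * S.ka ^ 2 * Scbar) / 2 * ‖(x t).2.2.2 - Wc‖ ^ 2 := by
    calc _ ≤ S.σc * (S.ηc - 2 * n * S.σa * S.ka ^ 2 * Scbar)
          * (1 / (2 * S.σc) * ‖(x t).2.2.2 - Wc‖ ^ 2) := by gcongr
      _ = _ := by field_simp
  have j4 : S.ι₁ μ₂ κ Scbar * (1 / 2 * ∑ i, ‖(x t).2.2.1 i - Wa i‖ ^ 2)
      ≤ S.σa * S.ηa / 2 * ∑ i, ‖(x t).2.2.1 i - Wa i‖ ^ 2 := by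
    calc _ ≤ S.σa * S.ηa * (1 / 2 * ∑ i, ‖(x t).2.2.1 i - Wa i‖ ^ 2) := by gcongr
      _ = _ := by ring
  rw [V, ι₂]
  linarith

end ArmControl

/-! ### Invariance of the operating region -/

namespace ArmControl

open Filter Topology Set

variable {n la lc : ℕ} {S : ArmControl n la lc}
variable {μ₁ μ₂ ℓ κ Sabar Scbar : ℝ}

theorem eventually_lt_of_hasDerivWithinAt_neg {f : ℝ → ℝ} {D t : ℝ}
    (h : HasDerivWithinAt f D (Ici t) t) (hD : D < 0) : ∀ᶠ s in 𝓝[>] t, f s < f t := by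
  have h1 := h.Ioi_of_Ici
  rw [hasDerivWithinAt_iff_tendsto_slope' (by simp)] at h1
  filter_upwards [h1.eventually (gt_mem_nhds hD), self_mem_nhdsWithin] with s hs hst
  have hst : t < s := hst
  rw [slope_def_field, div_lt_iff₀ (by linarith), zero_mul] at hs
  linarith

theorem V₁_le_V (hplant : S.PlantAssumptions μ₁ μ₂) (hσc : 0 < S.σc) (Wa : Fin n → Vec la)
    (Wc : Vec lc) (t : ℝ) (x : State n la lc) : S.V₁ t x.1 ≤ S.V Wa Wc t x := by
  have h1 := hplant.M_lower x.1 (S.Z₂ t x.1 x.2.1)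
  have h2 : 0 ≤ μ₁ * ‖S.Z₂ t x.1 x.2.1‖ ^ 2 := mul_nonneg hplant.μ₁_pos.le (sq_nonneg _)
  have h3 : 0 ≤ 1 / (2 * S.σc) * ‖x.2.2.2 - Wc‖ ^ 2 := by positivity
  have h4 : 0 ≤ 1 / 2 * ∑ i, ‖x.2.2.1 i - Wa i‖ ^ 2 := by positivity
  rw [V]
  linarith

theorem norm_Z₂_le (hplant : S.PlantAssumptions μ₁ μ₂) (hgain : S.GainAssumptions κ Sabar Scbar)
    {Wa : Fin n → Vec la} {Wc : Vec lc} {t v : ℝ} {x : State n la lc} (hgap : 0 < S.gap t x.1)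
    (hV : S.V Wa Wc t x ≤ v) : ‖S.Z₂ t x.1 x.2.1‖ ≤ √(2 * v / μ₁) := by
  have hσc := hgain.σc_pos
  have hμ := hplant.μ₁_pos
  have h1 := hplant.M_lower x.1 (S.Z₂ t x.1 x.2.1)
  have h2 := V₁_nonneg hgain.β_pos hgap
  have h3 : 0 ≤ 1 / (2 * S.σc) * ‖x.2.2.2 - Wc‖ ^ 2 := by positivity
  have h4 : 0 ≤ 1 / 2 * ∑ i, ‖x.2.2.1 i - Wa i‖ ^ 2 := by positivity
  refine Real.le_sqrt_of_sq_le ?_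
  rw [le_div_iff₀ hμ]
  rw [V] at hV
  linarith

/-- The barrier: a bound on the Lyapunov function keeps the gap open. -/
theorem gap_ge_of_V₁_le (href : S.RefAssumptions ℓ) (hβ : 0 < S.β) {t v : ℝ} (ht : 0 ≤ t)
    {q : Vec n} (hgap : 0 < S.gap t q) (hV : S.V₁ t q ≤ v) :
    S.kc t ^ 2 * Real.exp (-(2 * S.β * v)) ≤ S.gap t q := by
  have hk := href.kc_pos ht
  have h1 : Real.log (S.kc t ^ 2 / S.gap t q) ≤ 2 * S.β * v := by
    rw [V₁, one_div, inv_mul_le_iff₀ (by positivity)] at hV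
    exact hV
  rw [Real.log_le_iff_le_exp (by positivity), div_le_iff₀ hgap] at h1
  rw [Real.exp_neg, ← div_eq_mul_inv, div_le_iff₀ (Real.exp_pos _)]
  linarith

theorem RefAssumptions.rate_nonneg (href : S.RefAssumptions ℓ) : 0 ≤ ℓ :=
  (abs_nonneg _).trans (href.kc_rate 0 le_rfl)

theorem continuous_Z₁ (href : S.RefAssumptions ℓ) :
    Continuous (fun p : ℝ × State n la lc => S.Z₁ p.1 p.2.1) := by
  have h2 : Continuous S.qd := href.qd_smooth.continuous
  unfold Z₁
  fun_prop

/-- Growth of the tracking error while the Lyapunov function is at most `v`. Only the coupling to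
`Z₂` and the term `k̇_c / k_c` can increase `‖Z₁‖`; the other terms of `α` are damping. -/
theorem norm_Z₁_le_of_V_le (hplant : S.PlantAssumptions μ₁ μ₂) (href : S.RefAssumptions ℓ)
    (hgain : S.GainAssumptions κ Sabar Scbar) {Wa : Fin n → Vec la} {Wc : Vec lc} {v z t₀ t₁ : ℝ}
    (ht₀ : 0 ≤ t₀) {x : ℝ → State n la lc} (hc : ContinuousOn x (Icc t₀ t₁))
    (hx : ∀ t ∈ Ico t₀ t₁, HasDerivWithinAt x (S.field t (x t)) (Ici t) t)
    (hgap : ∀ t ∈ Ico t₀ t₁, 0 < S.gap t (x t).1) (hV : ∀ t ∈ Ico t₀ t₁, S.V Wa Wc t (x t) ≤ v)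
    (h₀ : ‖S.Z₁ t₀ (x t₀).1‖ ≤ Real.exp (ℓ * t₀) * (z + t₀ * √(2 * v / μ₁))) :
    ∀ t ∈ Icc t₀ t₁, ‖S.Z₁ t (x t).1‖ ≤ Real.exp (ℓ * t) * (z + t * √(2 * v / μ₁)) := by
  have hℓ := href.rate_nonneg
  set s := √(2 * v / μ₁) with hs
  have hs0 : 0 ≤ s := Real.sqrt_nonneg _
  have hz0 : 0 ≤ z + t₀ * s :=
    nonneg_of_mul_nonneg_right ((norm_nonneg _).trans h₀) (Real.exp_pos _)
  -- compare `‖Z₁‖²` with the square of a slightly larger, strictly faster growing bound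
  have key : ∀ ε > 0, ∀ t ∈ Icc t₀ t₁,
      ‖S.Z₁ t (x t).1‖ ^ 2 ≤ (Real.exp (ℓ * t) * (z + ε + t * (s + ε))) ^ 2 := by
    intro ε hε
    have hpos : ∀ t, t₀ ≤ t → 0 < Real.exp (ℓ * t) * (z + ε + t * (s + ε)) := by
      intro t ht
      have h1 : t₀ * s ≤ t * s := by gcongr
      have h2 : 0 ≤ t * ε := mul_nonneg (ht₀.trans ht) hε.le
      exact mul_pos (Real.exp_pos _) (by nlinarith)
    have hB : ∀ t, HasDerivAt (fun t => (Real.exp (ℓ * t) * (z + ε + t * (s + ε))) ^ 2)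
        (2 * (Real.exp (ℓ * t) * (z + ε + t * (s + ε))) *
          (ℓ * (Real.exp (ℓ * t) * (z + ε + t * (s + ε))) + Real.exp (ℓ * t) * (s + ε))) t := by
      intro t
      have h1 : HasDerivAt (fun t => Real.exp (ℓ * t)) (Real.exp (ℓ * t) * ℓ) t := by
        simpa using ((hasDerivAt_id t).const_mul ℓ).exp
      have h2 : HasDerivAt (fun t => z + ε + t * (s + ε)) (s + ε) t := by
        simpa using ((hasDerivAt_id t).mul_const (s + ε)).const_add (z + ε)
      refine ((h1.mul h2).pow 2).congr_deriv ?_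
      simp only [Pi.mul_apply]
      push_cast
      ring
    have hcont : ContinuousOn (fun t => ‖S.Z₁ t (x t).1‖ ^ 2) (Icc t₀ t₁) :=
      (((continuous_Z₁ href).comp_continuousOn (continuousOn_id.prodMk hc)).norm).pow 2
    have hder : ∀ t ∈ Ico t₀ t₁, HasDerivWithinAt (fun t => ‖S.Z₁ t (x t).1‖ ^ 2)
        (2 * ⟪S.Z₁ t (x t).1, (x t).2.1 - deriv S.qd t⟫) (Ici t) t := by
      intro t ht
      have hq : HasDerivWithinAt (fun r => (x r).1) (x t).2.1 (Ici t) t := (hx t ht).fst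
      exact (hq.sub (href.qd_smooth.differentiable two_ne_zero t).hasDerivAt.hasDerivWithinAt).norm_sq
    refine image_le_of_deriv_right_lt_deriv_boundary' hcont hder ?_
      (fun t _ => (hB t).continuousAt.continuousWithinAt) (fun t _ => (hB t).hasDerivWithinAt) ?_
    · gcongr
      refine h₀.trans ?_
      gcongr <;> linarith
    · intro t ht heq
      have htp := ht₀.trans ht.1
      set b := Real.exp (ℓ * t) * (z + ε + t * (s + ε)) with hb
      have hb0 : 0 < b := hpos t ht.1
      have hN : ‖S.Z₁ t (x t).1‖ = b := by
        rwa [pow_left_inj₀ (norm_nonneg _) hb0.le two_ne_zero] at heq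
      have hv : (x t).2.1 - deriv S.qd t = S.Z₂ t (x t).1 (x t).2.1 - S.K₁ • S.Z₁ t (x t).1
          - (S.a * shiftRate S.Tc t ^ 2 * ‖S.Z₁ t (x t).1‖ ^ 2 / (S.β * S.gap t (x t).1))
            • S.Z₁ t (x t).1
          + (deriv S.kc t / S.kc t) • S.Z₁ t (x t).1 := by
        simp only [Z₂, α]; abel
      have hZ₂ := norm_Z₂_le hplant hgain (hgap t ht) (hV t ht)
      have hin : ⟪S.Z₁ t (x t).1, S.Z₂ t (x t).1 (x t).2.1⟫ ≤ b * s := by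
        refine (real_inner_le_norm _ _).trans ?_
        rw [hN]
        gcongr
      have hρ : deriv S.kc t / S.kc t ≤ ℓ := (le_abs_self _).trans (href.kc_rate t htp)
      have hcoef : 0 ≤ S.a * shiftRate S.Tc t ^ 2 * ‖S.Z₁ t (x t).1‖ ^ 2
          / (S.β * S.gap t (x t).1) := by
        have := hgain.a_pos
        have := hgain.β_pos
        have := hgap t ht
        positivity
      rw [hv]
      simp only [inner_smul_right, inner_add_right, inner_sub_right, real_inner_self_eq_norm_sq]
      have h1 : S.K₁ * ‖S.Z₁ t (x t).1‖ ^ 2 ≥ 0 :=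
        mul_nonneg (by linarith [hgain.K₁_gt]) (sq_nonneg _)
      have h2 := mul_nonneg hcoef (sq_nonneg ‖S.Z₁ t (x t).1‖)
      have h3 := mul_le_mul_of_nonneg_right hρ (sq_nonneg ‖S.Z₁ t (x t).1‖)
      have h4 : (1 : ℝ) ≤ Real.exp (ℓ * t) := Real.one_le_exp (mul_nonneg hℓ htp)
      have h5 : b * s < b * (Real.exp (ℓ * t) * (s + ε)) := by
        have : s + ε ≤ Real.exp (ℓ * t) * (s + ε) := le_mul_of_one_le_left (by linarith) h4
        exact mul_lt_mul_of_pos_left (by linarith) hb0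
      rw [hN] at h1 h2 h3 ⊢
      nlinarith
  intro t ht
  have htp := ht₀.trans ht.1
  have hlim : Tendsto (fun ε => Real.exp (ℓ * t) * (z + ε + t * (s + ε))) (𝓝[>] 0)
      (𝓝 (Real.exp (ℓ * t) * (z + 0 + t * (s + 0)))) :=
    (Continuous.tendsto (by fun_prop) 0).mono_left nhdsWithin_le_nhds
  simp only [add_zero] at hlim
  refine ge_of_tendsto hlim ?_
  filter_upwards [self_mem_nhdsWithin] with ε hε
  have hε : 0 < ε := hε
  refine (pow_le_pow_iff_left₀ (norm_nonneg _) ?_ two_ne_zero).1 (key ε hε t ht)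
  have h1 : t₀ * s ≤ t * s := by gcongr; exact ht.1
  have h2 : 0 ≤ t * ε := mul_nonneg htp hε.le
  exact mul_nonneg (Real.exp_pos _).le (by nlinarith)

/-- The networks approximate at the point `(t, x)`. -/
def ApproxAt (S : ArmControl n la lc) (Wa : Fin n → Vec la) (Wc : Vec lc) (εa ec t : ℝ)
    (x : State n la lc) : Prop :=
  ‖S.f t x - S.actorOut t x.1 x.2.1 Wa‖ ≤ εa ∧ |S.tdError t x Wc| ≤ ec

/-- A solution that starts in the region cannot leave it, provided that the networks approximate
at those of its points that lie in the region: on the boundary `V = v` the function `V` decreases,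
because `v > ι₂ / ι₁`. -/
theorem mem_region_of_isRightSolution (hplant : S.PlantAssumptions μ₁ μ₂)
    (href : S.RefAssumptions ℓ) (hgain : S.GainAssumptions κ Sabar Scbar) {Wa : Fin n → Vec la}
    {Wc : Vec lc} {εa ec v z T : ℝ} (hv : S.ι₂ Sabar Scbar Wa Wc εa ec / S.ι₁ μ₂ κ Scbar < v)
    {x : ℝ → State n la lc} (hx : IsRightSolution S.field (Ico 0 T) x)
    (h₀ : (0, x 0) ∈ S.region μ₁ ℓ Wa Wc v z)
    (happ : ∀ t ∈ Ico 0 T, (t, x t) ∈ S.region μ₁ ℓ Wa Wc v z → S.ApproxAt Wa Wc εa ec t (x t)) :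
    ∀ t ∈ Ico 0 T, (t, x t) ∈ S.region μ₁ ℓ Wa Wc v z := by
  have hβ := hgain.β_pos
  have hι := ι₁_pos hplant hgain
  set bd : ℝ → ℝ := fun t => Real.exp (ℓ * t) * (z + t * √(2 * v / μ₁)) with hbd
  set A : Set ℝ := {t | S.kc t ^ 2 * Real.exp (-(2 * S.β * v)) ≤ S.gap t (x t).1 ∧
    ‖S.Z₁ t (x t).1‖ ≤ bd t} with hA
  have hApos : ∀ t, 0 ≤ t → t ∈ A → 0 < S.gap t (x t).1 := by
    intro t ht hAt
    have := href.kc_pos ht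
    exact (by positivity : 0 < S.kc t ^ 2 * Real.exp (-(2 * S.β * v))).trans_le hAt.1
  suffices h : ∀ b ∈ Ico 0 T, Icc 0 b ⊆ {t | t ∈ A ∧ S.V Wa Wc t (x t) ≤ v} by
    intro t ht
    have h1 := h t ht ⟨ht.1, le_rfl⟩
    exact ⟨ht.1, hApos t ht.1 h1.1, h1.2, fun _ => h1.1.2⟩
  intro b hb
  have hIcc : Icc 0 b ⊆ Ico 0 T := fun t ht => ⟨ht.1, ht.2.trans_lt hb.2⟩
  have hpair : ContinuousOn (fun t => (t, x t)) (Icc 0 b) :=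
    continuousOn_id.prodMk (hx.1.mono hIcc)
  have hAcl : IsClosed (Icc 0 b ∩ A) := by
    have hkc := href.kc_smooth.continuous
    have h1 : ContinuousOn (fun t => S.gap t (x t).1
        - S.kc t ^ 2 * Real.exp (-(2 * S.β * v))) (Icc 0 b) :=
      ((continuous_gap href).comp_continuousOn hpair).sub (by fun_prop)
    have h2 : ContinuousOn (fun t => bd t - ‖S.Z₁ t (x t).1‖) (Icc 0 b) :=
      (Continuous.continuousOn (by fun_prop)).sub
        ((continuous_Z₁ href).comp_continuousOn hpair).norm
    have := (h1.prodMk h2).preimage_isClosed_of_isClosed isClosed_Icc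
      ((isClosed_Ici (a := (0 : ℝ))).prod (isClosed_Ici (a := (0 : ℝ))))
    convert this using 1
    ext t
    simp [hA]
  have hcl : IsClosed ({t | t ∈ A ∧ S.V Wa Wc t (x t) ≤ v} ∩ Icc 0 b) := by
    have hVc : ContinuousOn (fun t => S.V Wa Wc t (x t)) (Icc 0 b ∩ A) := by
      intro t ht
      exact ContinuousAt.comp_continuousWithinAt (f := fun t => (t, x t))
        (continuousAt_V hplant href hβ Wa Wc (p := (t, x t)) ht.1.1
          (hApos t ht.1.1 ht.2)) ((hpair.mono inter_subset_left) t ht)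
    have := hVc.preimage_isClosed_of_isClosed hAcl (isClosed_Iic (a := v))
    convert this using 1
    ext t
    simp only [mem_inter_iff, mem_ofPred_eq, mem_preimage, mem_Iic]
    tauto
  refine hcl.Icc_subset_of_forall_mem_nhdsWithin ?_ ?_
  · refine ⟨⟨gap_ge_of_V₁_le href hβ le_rfl h₀.2.1
      ((V₁_le_V hplant hgain.σc_pos Wa Wc 0 (x 0)).trans h₀.2.2.1), ?_⟩, h₀.2.2.1⟩
    exact h₀.2.2.2 hgain.Tc_pos.le
  rintro t ⟨⟨htA, htV⟩, ht⟩
  have htT : t ∈ Ico 0 T := hIcc (Ico_subset_Icc_self ht)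
  have hg := hApos t ht.1 htA
  obtain ⟨hε, he⟩ := happ t htT ⟨ht.1, hg, htV, fun _ => htA.2⟩
  obtain ⟨D, hD, hDle⟩ := hasDerivWithinAt_V hplant href hgain ht.1 (hx.2 t htT) hg hε he
  have hVev : ∀ᶠ r in 𝓝[≥] t, S.V Wa Wc r (x r) ≤ v := by
    rcases htV.lt_or_eq with h | h
    · filter_upwards [hD.continuousWithinAt.eventually (gt_mem_nhds h)] with r hr using le_of_lt hr
    · have hneg : D < 0 := by
        rw [div_lt_iff₀ hι] at hv
        rw [h] at hDle
        linarith
      rw [← Ioi_insert, nhdsWithin_insert, eventually_sup]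
      refine ⟨htV, ?_⟩
      filter_upwards [eventually_lt_of_hasDerivWithinAt_neg hD hneg] with r hr
      exact hr.le.trans htV
  have hgev : ∀ᶠ r in 𝓝[≥] t, 0 < S.gap r (x r).1 := by
    have h1 : ContinuousWithinAt (fun r => S.gap r (x r).1) (Ici t) t :=
      (continuous_gap href).continuousAt.comp_continuousWithinAt (f := fun r => (r, x r))
        (continuousWithinAt_id.prodMk (hx.2 t htT).continuousWithinAt)
    exact h1.eventually (lt_mem_nhds hg)
  obtain ⟨u, hu, hsub⟩ := mem_nhdsGE_iff_exists_Icc_subset.1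
    (inter_mem hVev (inter_mem hgev (Icc_mem_nhdsGE ht.2)))
  have hu' : t < u := hu
  have hsubT : Icc t u ⊆ Ico 0 T := fun r hr => hIcc ⟨ht.1.trans hr.1, (hsub hr).2.2.2⟩
  have hZ := norm_Z₁_le_of_V_le hplant href hgain ht.1 (hx.1.mono hsubT)
    (fun r hr => hx.2 r (hsubT (Ico_subset_Icc_self hr)))
    (fun r hr => (hsub (Ico_subset_Icc_self hr)).2.1)
    (fun r hr => (hsub (Ico_subset_Icc_self hr)).1) htA.2
  filter_upwards [Ioc_mem_nhdsGT hu'] with r hr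
  have hr' : r ∈ Icc t u := Ioc_subset_Icc_self hr
  refine ⟨⟨gap_ge_of_V₁_le href hβ (hsubT hr').1 (hsub hr').2.1
    ((V₁_le_V hplant hgain.σc_pos Wa Wc r (x r)).trans (hsub hr').1), hZ r hr'⟩, (hsub hr').1⟩

/-- Exponential decay of the Lyapunov function to the level `ι₂ / ι₁`. -/
theorem V_le_of_isRightSolution (hplant : S.PlantAssumptions μ₁ μ₂)
    (href : S.RefAssumptions ℓ) (hgain : S.GainAssumptions κ Sabar Scbar) {Wa : Fin n → Vec la}
    {Wc : Vec lc} {εa ec v T : ℝ} {x : ℝ → State n la lc}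
    (hx : IsRightSolution S.field (Ico 0 T) x) (h₀ : S.V Wa Wc 0 (x 0) ≤ v)
    (hgap : ∀ t ∈ Ico 0 T, 0 < S.gap t (x t).1)
    (happ : ∀ t ∈ Ico 0 T, S.ApproxAt Wa Wc εa ec t (x t)) :
    ∀ t ∈ Ico 0 T, S.V Wa Wc t (x t) ≤
      S.ι₂ Sabar Scbar Wa Wc εa ec / S.ι₁ μ₂ κ Scbar + v * Real.exp (-S.ι₁ μ₂ κ Scbar * t) := by
  intro b hb
  have hι := ι₁_pos hplant hgain
  have hι₂ := ι₂_pos hgain Wa Wc εa ec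
  have hIcc : Icc 0 b ⊆ Ico 0 T := fun t ht => ⟨ht.1, ht.2.trans_lt hb.2⟩
  have hder : ∀ t ∈ Ico 0 T, ∃ D, HasDerivWithinAt (fun r => S.V Wa Wc r (x r)) D (Ici t) t ∧
      D ≤ -S.ι₁ μ₂ κ Scbar * S.V Wa Wc t (x t) + S.ι₂ Sabar Scbar Wa Wc εa ec := fun t ht =>
    hasDerivWithinAt_V hplant href hgain ht.1 (hx.2 t ht) (hgap t ht) (happ t ht).1 (happ t ht).2
  choose! D hD hDle using hder
  have hVc : ContinuousOn (fun t => S.V Wa Wc t (x t)) (Icc 0 b) := by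
    intro t ht
    exact ContinuousAt.comp_continuousWithinAt (f := fun t => (t, x t))
      (continuousAt_V hplant href hgain.β_pos Wa Wc (p := (t, x t)) ht.1 (hgap t (hIcc ht)))
      ((continuousOn_id.prodMk (hx.1.mono hIcc)) t ht)
  have h := le_gronwallBound_of_liminf_deriv_right_le (f' := D) hVc
    (fun t ht _ hr => (hD t (hIcc (Ico_subset_Icc_self ht))).liminf_right_slope_le hr) h₀
    (fun t ht => hDle t (hIcc (Ico_subset_Icc_self ht))) b ⟨hb.1, le_rfl⟩
  rw [gronwallBound_of_K_ne_0 (neg_ne_zero.2 hι.ne'), sub_zero] at h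
  have h2 : S.ι₂ Sabar Scbar Wa Wc εa ec / -S.ι₁ μ₂ κ Scbar
      * (Real.exp (-S.ι₁ μ₂ κ Scbar * b) - 1) = S.ι₂ Sabar Scbar Wa Wc εa ec / S.ι₁ μ₂ κ Scbar
      - S.ι₂ Sabar Scbar Wa Wc εa ec / S.ι₁ μ₂ κ Scbar * Real.exp (-S.ι₁ μ₂ κ Scbar * b) := by
    rw [div_neg]; ring
  have h3 : 0 ≤ S.ι₂ Sabar Scbar Wa Wc εa ec / S.ι₁ μ₂ κ Scbar
      * Real.exp (-S.ι₁ μ₂ κ Scbar * b) := by positivity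
  linarith

end ArmControl

/-! ### Bounds on the closed-loop signals -/

section BddOn

variable {α E F G : Type*} [NormedAddCommGroup E] [NormedAddCommGroup F] [NormedAddCommGroup G]
  {A : Set α}

/-- The function `f` is bounded in norm on `A`. -/
def NormBddOn (A : Set α) (f : α → E) : Prop := ∃ B, ∀ p ∈ A, ‖f p‖ ≤ B

theorem NormBddOn.mono_norm {f : α → E} {g : α → F} (hg : NormBddOn A g)
    (h : ∀ p ∈ A, ‖f p‖ ≤ ‖g p‖) : NormBddOn A f :=
  hg.imp fun _ hB p hp => (h p hp).trans (hB p hp)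

theorem NormBddOn.congr {f g : α → E} (hg : NormBddOn A g) (h : ∀ p ∈ A, f p = g p) :
    NormBddOn A f :=
  hg.mono_norm fun p hp => by rw [h p hp]

theorem NormBddOn.prodMk {f : α → E} {g : α → F} (hf : NormBddOn A f) (hg : NormBddOn A g) :
    NormBddOn A (fun p => (f p, g p)) := by
  obtain ⟨B, hB⟩ := hf
  obtain ⟨B', hB'⟩ := hg
  exact ⟨max B B', fun p hp => max_le_max (hB p hp) (hB' p hp)⟩

theorem NormBddOn.comp [ProperSpace E] {Φ : E → F} (hΦ : Continuous Φ) {f : α → E}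
    (hf : NormBddOn A f) : NormBddOn A (fun p => Φ (f p)) := by
  obtain ⟨B, hB⟩ := hf
  obtain ⟨B', hB'⟩ := (isCompact_closedBall (0 : E) B).exists_bound_of_continuousOn
    hΦ.continuousOn
  exact ⟨B', fun p hp => hB' _ (mem_closedBall_zero_iff.2 (hB p hp))⟩

theorem NormBddOn.comp₂ [ProperSpace E] [ProperSpace F] {Φ : E × F → G} (hΦ : Continuous Φ)
    {f : α → E} {g : α → F} (hf : NormBddOn A f) (hg : NormBddOn A g) :
    NormBddOn A (fun p => Φ (f p, g p)) :=
  (hf.prodMk hg).comp hΦ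

theorem NormBddOn.add {f g : α → E} (hf : NormBddOn A f) (hg : NormBddOn A g) :
    NormBddOn A (fun p => f p + g p) := by
  obtain ⟨B, hB⟩ := hf
  obtain ⟨B', hB'⟩ := hg
  exact ⟨B + B', fun p hp => norm_add_le_of_le (hB p hp) (hB' p hp)⟩

theorem NormBddOn.neg {f : α → E} (hf : NormBddOn A f) : NormBddOn A (fun p => -f p) :=
  hf.mono_norm fun _ _ => (norm_neg _).le

theorem NormBddOn.sub {f g : α → E} (hf : NormBddOn A f) (hg : NormBddOn A g) :
    NormBddOn A (fun p => f p - g p) := by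
  simpa [sub_eq_add_neg] using hf.add hg.neg

theorem NormBddOn.const (c : E) : NormBddOn A (fun _ => c) := ⟨‖c‖, fun _ _ => le_rfl⟩

theorem NormBddOn.smul [NormedSpace ℝ E] {c : α → ℝ} {f : α → E} (hc : NormBddOn A c)
    (hf : NormBddOn A f) : NormBddOn A (fun p => c p • f p) := by
  obtain ⟨B, hB⟩ := hc
  obtain ⟨B', hB'⟩ := hf
  refine ⟨B * B', fun p hp => ?_⟩
  rw [norm_smul]
  exact mul_le_mul (hB p hp) (hB' p hp) (norm_nonneg _) ((norm_nonneg _).trans (hB p hp))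

theorem NormBddOn.mul {c d : α → ℝ} (hc : NormBddOn A c) (hd : NormBddOn A d) :
    NormBddOn A (fun p => c p * d p) := hc.smul hd

theorem NormBddOn.inv {c : α → ℝ} {m : ℝ} (hm : 0 < m) (h : ∀ p ∈ A, m ≤ c p) :
    NormBddOn A (fun p => (c p)⁻¹) := by
  refine ⟨m⁻¹, fun p hp => ?_⟩
  rw [Real.norm_of_nonneg (inv_nonneg.2 (hm.le.trans (h p hp)))]
  gcongr
  exact h p hp

end BddOn

namespace ArmControl

variable {n la lc : ℕ} {S : ArmControl n la lc}
variable {μ₁ μ₂ ℓ κ Sabar Scbar : ℝ}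

/-- All signals and the closed-loop field are bounded, uniformly in time, in terms of bounds on `V`
and `‖Z₁‖`. No bound on `q̈_d` and `k̈_c` is available; `α̇` is bounded because the networks
approximate `f`, of which it is the only summand not bounded otherwise. -/
theorem exists_signalsLE (hplant : S.PlantAssumptions μ₁ μ₂)
    (href : S.RefAssumptions ℓ) (hgain : S.GainAssumptions κ Sabar Scbar) (Wa : Fin n → Vec la)
    (Wc : Vec lc) (εa ec v z : ℝ) :
    ∃ B, ∀ t x, 0 ≤ t → 0 < S.gap t x.1 → S.V Wa Wc t x ≤ v → ‖S.Z₁ t x.1‖ ≤ z →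
      S.ApproxAt Wa Wc εa ec t x → S.SignalsLE t x B ∧ ‖S.field t x‖ ≤ B := by
  have hβ := hgain.β_pos
  have hσc := hgain.σc_pos
  have hμ := hplant.μ₁_pos
  let A : Set (ℝ × State n la lc) := {p | 0 ≤ p.1 ∧ 0 < S.gap p.1 p.2.1 ∧ S.V Wa Wc p.1 p.2 ≤ v ∧
    ‖S.Z₁ p.1 p.2.1‖ ≤ z ∧ S.ApproxAt Wa Wc εa ec p.1 p.2}
  -- signals of the reference
  have hqd : NormBddOn A (fun p => S.qd p.1) := by
    obtain ⟨b, hb⟩ := href.qd_bdd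
    exact ⟨b, fun p hp => (hb p.1 hp.1).1⟩
  have hqd' : NormBddOn A (fun p => deriv S.qd p.1) := by
    obtain ⟨b, hb⟩ := href.qd_bdd
    exact ⟨b, fun p hp => (hb p.1 hp.1).2⟩
  have hd : NormBddOn A (fun p => S.d p.1) := by
    obtain ⟨b, hb⟩ := hplant.d_bdd
    exact ⟨b, fun p hp => hb p.1 hp.1⟩
  have hγ : NormBddOn A (fun p => shift S.Tc p.1) :=
    ⟨1, fun p hp => abs_shift_le_one hgain.Tc_pos hp.1⟩
  have hγ' : NormBddOn A (fun p => shiftRate S.Tc p.1) :=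
    ⟨_, fun p hp => abs_shiftRate_le hgain.Tc_pos hp.1⟩
  have hρ : NormBddOn A (fun p => deriv S.kc p.1 / S.kc p.1) :=
    ⟨ℓ, fun p hp => href.kc_rate p.1 hp.1⟩
  have hginv : NormBddOn A (fun p => (S.β * S.gap p.1 p.2.1)⁻¹) := by
    obtain ⟨b, hb, hbk⟩ := href.kc_lower
    refine NormBddOn.inv (m := S.β * (b ^ 2 * Real.exp (-(2 * S.β * v)))) (by positivity)
      fun p hp => ?_
    have h1 := gap_ge_of_V₁_le href hβ hp.1 hp.2.1
      ((V₁_le_V hplant hσc Wa Wc p.1 p.2).trans hp.2.2.1)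
    have h2 := hbk p.1 hp.1
    refine mul_le_mul_of_nonneg_left (le_trans ?_ h1) hβ.le
    gcongr
  -- errors, positions, velocities
  have hZ₁ : NormBddOn A (fun p => S.Z₁ p.1 p.2.1) := ⟨z, fun p hp => hp.2.2.2.1⟩
  have hq : NormBddOn A (fun p => p.2.1) :=
    (hZ₁.add hqd).congr fun p _ => by rw [Z₁, sub_add_cancel]
  have hZ₂ : NormBddOn A (fun p => S.Z₂ p.1 p.2.1 p.2.2.1) :=
    ⟨_, fun p hp => norm_Z₂_le hplant hgain hp.2.1 hp.2.2.1⟩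
  have hα : NormBddOn A (fun p => S.α p.1 p.2.1) := by
    have h1 : NormBddOn A (fun p => S.a * shiftRate S.Tc p.1 ^ 2 * ‖S.Z₁ p.1 p.2.1‖ ^ 2
        / (S.β * S.gap p.1 p.2.1)) :=
      ((((NormBddOn.const S.a).mul (hγ'.comp (Φ := fun y => y ^ 2) (by fun_prop))).mul
        (hZ₁.comp (Φ := fun y => ‖y‖ ^ 2) (by fun_prop))).mul hginv).congr
        fun p _ => div_eq_mul_inv _ _
    exact ((((NormBddOn.const S.K₁).smul hZ₁).neg.sub (h1.smul hZ₁)).add hqd').add (hρ.smul hZ₁)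
  have hv : NormBddOn A (fun p => p.2.2.1) :=
    (hZ₂.add hα).congr fun p _ => by rw [Z₂, sub_add_cancel]
  -- weights
  have hVparts : ∀ p ∈ A, 1 / (2 * S.σc) * ‖p.2.2.2.2 - Wc‖ ^ 2 ≤ v ∧
      1 / 2 * ∑ i, ‖p.2.2.2.1 i - Wa i‖ ^ 2 ≤ v := by
    intro p hp
    have h1 := V₁_nonneg hβ hp.2.1
    have h2 : 0 ≤ μ₁ * ‖S.Z₂ p.1 p.2.1 p.2.2.1‖ ^ 2 := by positivity
    have h3 := hplant.M_lower p.2.1 (S.Z₂ p.1 p.2.1 p.2.2.1)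
    have h4 : 0 ≤ 1 / (2 * S.σc) * ‖p.2.2.2.2 - Wc‖ ^ 2 := by positivity
    have h5 : 0 ≤ 1 / 2 * ∑ i, ‖p.2.2.2.1 i - Wa i‖ ^ 2 := by positivity
    have h6 := hp.2.2.1
    rw [V] at h6
    constructor <;> linarith
  have hWc : NormBddOn A (fun p => p.2.2.2.2) := by
    have h1 : NormBddOn A (fun p => p.2.2.2.2 - Wc) := by
      refine ⟨√(2 * S.σc * v), fun p hp => Real.le_sqrt_of_sq_le ?_⟩
      have := (hVparts p hp).1
      rwa [one_div, inv_mul_le_iff₀ (by positivity)] at this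
    exact (h1.add (NormBddOn.const Wc)).congr fun p _ => by rw [sub_add_cancel]
  have hWa : NormBddOn A (fun p => p.2.2.2.1) := by
    have h1 : NormBddOn A (fun p => p.2.2.2.1 - Wa) := by
      refine ⟨√(2 * v), fun p hp => (pi_norm_le_iff_of_nonneg (Real.sqrt_nonneg _)).2 fun i =>
        Real.le_sqrt_of_sq_le ?_⟩
      have h1 := (hVparts p hp).2
      have h2 := Finset.single_le_sum (f := fun i => ‖p.2.2.2.1 i - Wa i‖ ^ 2)
        (fun i _ => sq_nonneg _) (Finset.mem_univ i)
      simp only [Pi.sub_apply]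
      linarith
    exact (h1.add (NormBddOn.const Wa)).congr fun p _ => by rw [sub_add_cancel]
  -- networks and control
  have hZc : NormBddOn A (fun p => S.Zc p.1 p.2.1 p.2.2.1) :=
    hZ₁.comp₂ (contDiff_stack₂ (k := 0)).continuous hZ₂
  have hSa : NormBddOn A (fun p => S.Sa (S.Za p.1 p.2.1 p.2.2.1)) :=
    ⟨√Sabar, fun p _ => Real.le_sqrt_of_sq_le (hgain.Sa_le _)⟩
  have hSc : NormBddOn A (fun p => S.Sc (S.Zc p.1 p.2.1 p.2.2.1)) :=
    ⟨√Scbar, fun p _ => Real.le_sqrt_of_sq_le (hgain.Sc_le _)⟩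
  have hΦ : Continuous (fun p : (Fin n → Vec la) × Vec la =>
      (WithLp.toLp 2 (fun i => ⟪p.1 i, p.2⟫) : Vec n)) :=
    (PiLp.continuous_toLp 2 _).comp (continuous_pi fun i =>
      Continuous.inner (by fun_prop) (by fun_prop))
  have hact : NormBddOn A (fun p => S.actorOut p.1 p.2.1 p.2.2.1 p.2.2.2.1) := hWa.comp₂ hΦ hSa
  have hτ : NormBddOn A (fun p => S.τ p.1 p.2) := by
    have h1 : NormBddOn A (fun p => (shift S.Tc p.1 / (S.β * S.gap p.1 p.2.1))
        • S.Zγ p.1 p.2.1) :=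
      ((hγ.mul hginv).smul (hγ.smul hZ₁)).congr fun p _ => by rw [div_eq_mul_inv, Zγ]
    exact (hact.sub (hZ₂.comp S.K₂.continuous)).sub h1
  have hC := hq.comp₂ (continuous_C hplant) hv
  have hG := hq.comp hplant.G_lip.continuous
  have happly : Continuous (fun p : (Vec n →L[ℝ] Vec n) × Vec n => p.1 p.2) := by fun_prop
  have hacc : NormBddOn A (fun p => S.accel p.1 p.2) := by
    have h1 := ((hτ.add hd).sub (hC.comp₂ happly hv)).sub hG
    exact (hq.comp hplant.contDiff_M_inverse.continuous).comp₂ happly h1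
  have hf : NormBddOn A (fun p => S.f p.1 p.2) := by
    have h1 : NormBddOn A (fun p => S.f p.1 p.2 - S.actorOut p.1 p.2.1 p.2.2.1 Wa) :=
      ⟨εa, fun p hp => hp.2.2.2.2.1⟩
    exact (h1.add ((NormBddOn.const Wa).comp₂ hΦ hSa)).congr fun p _ => by
      simp only [actorOut, sub_add_cancel]
  have hMα : NormBddOn A (fun p => S.M p.2.1 (S.αDot p.1 p.2.1 p.2.2.1)) :=
    (((hf.add hd).sub (hC.comp₂ happly hα)).sub hG).congr fun p _ => by
      simp only [f]; abel
  have hαDot : NormBddOn A (fun p => S.αDot p.1 p.2.1 p.2.2.1) := by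
    obtain ⟨b, hb⟩ := hMα
    refine ⟨b / μ₁, fun p hp => (hplant.norm_le p.2.1 _).trans ?_⟩
    gcongr
    exact hb p hp
  have hin : Continuous (fun p : Vec lc × Vec lc => ⟪p.1, p.2⟫) := by fun_prop
  have hJ : NormBddOn A (fun p => S.Jhat p.1 p.2) := hWc.comp₂ hin hSc
  have hcost : NormBddOn A (fun p => S.cost p.1 p.2) :=
    (hZc.comp (Φ := fun y => ⟪y, S.Q y⟫) (by fun_prop)).add
      (hτ.comp (Φ := fun y => ⟪y, S.R y⟫) (by fun_prop))
  have hZcDot : NormBddOn A (fun p => S.ZcDot p.1 p.2) :=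
    (hv.sub hqd').comp₂ (contDiff_stack₂ (k := 0)).continuous (hacc.sub hαDot)
  have hΛ : NormBddOn A (fun p => S.Λ p.1 p.2) := by
    have h1 : Continuous (fun p : Stack 2 n × Stack 2 n => fderiv ℝ S.Sc p.1 p.2) :=
      (((contDiff_rbf S.criticCenter S.criticWidth 1).continuous_fderiv one_ne_zero).comp
        continuous_fst).clm_apply continuous_snd
    exact ((NormBddOn.const (1 / S.ψ)).smul hSc).neg.add (hZc.comp₂ h1 hZcDot)
  have htd : NormBddOn A (fun p => S.tdError p.1 p.2 p.2.2.2.2) := hcost.add (hWc.comp₂ hin hΛ)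
  have hcr : NormBddOn A (fun p => S.criticRate p.1 p.2) :=
    (((NormBddOn.const S.σc).mul htd).smul hΛ).neg.sub
      ((NormBddOn.const (S.σc * S.ηc)).smul hWc)
  have har : NormBddOn A (fun p => S.actorRate p.1 p.2) := by
    refine ((hact.prodMk (hZ₂.prodMk hJ)).prodMk (hSa.prodMk hWa)).comp
      (Φ := fun p : (Vec n × Vec n × ℝ) × Vec la × (Fin n → Vec la) => fun i : Fin n =>
        -((S.σa * (p.1.1 i + p.1.2.1 i / S.σa + S.ka * p.1.2.2)) • p.2.1)
          - (S.σa * S.ηa) • p.2.2 i) ?_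
    fun_prop
  have hfield : NormBddOn A (fun p => S.field p.1 p.2) :=
    hv.prodMk (hacc.prodMk (har.prodMk hcr))
  obtain ⟨B, hB⟩ := hq.prodMk <| hv.prodMk <| hacc.prodMk <| hZ₁.prodMk <| hZ₂.prodMk <|
    hα.prodMk <| hαDot.prodMk <| hτ.prodMk <| hWa.prodMk <| hWc.prodMk <| hJ.prodMk <|
    hcost.prodMk <| hΛ.prodMk <| htd.prodMk hfield
  refine ⟨B, fun t x ht hgap hV hz happ => ?_⟩
  have h := hB (t, x) ⟨ht, hgap, hV, hz, happ⟩
  simp only [norm_prod_le_iff, Real.norm_eq_abs] at h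
  unfold SignalsLE
  simp only [norm_prod_le_iff]
  tauto

end ArmControl

/-! ### Performance of solutions -/

namespace ArmControl

open Filter Topology Set

variable {n la lc : ℕ} {S : ArmControl n la lc}
variable {μ₁ μ₂ ℓ κ Sabar Scbar : ℝ}

theorem exists_forall_mul_exp_neg_le {ι : ℝ} (hι : 0 < ι) (v : ℝ) {δ : ℝ} (hδ : 0 < δ) :
    ∃ T, ∀ t, T ≤ t → v * Real.exp (-ι * t) ≤ δ := by
  have h1 : Tendsto (fun t => v * Real.exp (-ι * t)) atTop (𝓝 (v * 0)) := by
    refine Tendsto.const_mul v (Real.tendsto_exp_atBot.comp ?_)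
    exact tendsto_id.const_mul_atTop_of_neg (neg_neg_iff_pos.2 hι)
  rw [mul_zero] at h1
  obtain ⟨T, hT⟩ := eventually_atTop.1 (h1.eventually (gt_mem_nhds hδ))
  exact ⟨T, fun t ht => (hT t ht).le⟩

theorem norm_Zγ_lt_kc (href : S.RefAssumptions ℓ) {t : ℝ} (ht : 0 ≤ t) {q : Vec n}
    (hgap : 0 < S.gap t q) : ‖S.Zγ t q‖ < S.kc t := by
  rw [gap] at hgap
  exact lt_of_pow_lt_pow_left₀ 2 (href.kc_pos ht).le (by linarith)

theorem Zγ_of_le {t : ℝ} (ht : S.Tc ≤ t) (q : Vec n) : S.Zγ t q = S.Z₁ t q := by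
  rw [Zγ, shift_of_le ht, one_smul]

theorem mem_admissible_of_norm_Z₁_lt {t : ℝ} {q : Vec n} (h : ‖S.Z₁ t q‖ < S.kc t) :
    q ∈ S.admissible t := by
  intro i
  have h1 : S.kc t ≤ min (S.kUp i t - S.qd t i) (S.qd t i - S.kLow i t) :=
    ciInf_le (Finite.bddBelow_range _) i
  have h2 : |q i - S.qd t i| ≤ ‖S.Z₁ t q‖ := PiLp.norm_apply_le (S.Z₁ t q) i
  have h3 := abs_le.1 h2
  have h4 := le_min_iff.1 h1
  constructor <;> linarith

/-- The radius of the residual set depends continuously on the level of `V`, uniformly for bounded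
`k_c`. -/
theorem exists_radius_le (β c k : ℝ) {ε : ℝ} (hε : 0 < ε) :
    ∃ δ > 0, ∀ κ, 0 < κ → κ ≤ k → κ * √(1 - Real.exp (-(2 * β * (c + δ))))
      ≤ κ * √(1 - Real.exp (-(2 * β * c))) + ε := by
  have hη : 0 < ε / (|k| + 1) := by positivity
  have h1 : Tendsto (fun δ => √(1 - Real.exp (-(2 * β * (c + δ))))) (𝓝[>] 0)
      (𝓝 √(1 - Real.exp (-(2 * β * (c + 0))))) :=
    (Continuous.tendsto (by fun_prop) 0).mono_left nhdsWithin_le_nhds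
  rw [add_zero] at h1
  obtain ⟨δ, hδ, hδ0⟩ := ((h1.eventually (gt_mem_nhds (lt_add_of_pos_right _ hη))).and
    self_mem_nhdsWithin).exists
  refine ⟨δ, hδ0, fun κ hκ hκk => ?_⟩
  calc κ * √(1 - Real.exp (-(2 * β * (c + δ))))
      ≤ κ * (√(1 - Real.exp (-(2 * β * c))) + ε / (|k| + 1)) := by gcongr
    _ = κ * √(1 - Real.exp (-(2 * β * c))) + κ * (ε / (|k| + 1)) := by ring
    _ ≤ κ * √(1 - Real.exp (-(2 * β * c))) + (|k| + 1) * (ε / (|k| + 1)) := by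
        gcongr
        linarith [le_abs_self k]
    _ = κ * √(1 - Real.exp (-(2 * β * c))) + ε := by
        congr 1; field_simp

theorem norm_Z₁_le_radius (href : S.RefAssumptions ℓ) (hβ : 0 < S.β) {t v : ℝ} (ht : 0 ≤ t)
    (hTc : S.Tc ≤ t) {q : Vec n} (hgap : 0 < S.gap t q) (hV : S.V₁ t q ≤ v) :
    ‖S.Z₁ t q‖ ≤ S.kc t * √(1 - Real.exp (-(2 * S.β * v))) := by
  have h1 := gap_ge_of_V₁_le href hβ ht hgap hV
  rw [gap, Zγ_of_le hTc] at h1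
  have hk := href.kc_pos ht
  rw [← Real.sqrt_sq hk.le, ← Real.sqrt_mul (sq_nonneg _)]
  refine Real.le_sqrt_of_sq_le ?_
  linarith

/-- In the operating region the tracking error is bounded: up to the time `T_c` by the growth
estimate, and later by the barrier. -/
theorem norm_Z₁_le_of_mem_region (href : S.RefAssumptions ℓ) {k : ℝ}
    (hk : ∀ t, 0 ≤ t → S.kc t ≤ k) {Wa : Fin n → Vec la} {Wc : Vec lc} {v z t : ℝ}
    {x : State n la lc} (h : (t, x) ∈ S.region μ₁ ℓ Wa Wc v z) :
    ‖S.Z₁ t x.1‖ ≤ max k (Real.exp (ℓ * S.Tc) * (|z| + S.Tc * √(2 * v / μ₁))) := by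
  obtain ⟨ht : 0 ≤ t, hgap, -, hZ⟩ := h
  have hℓ := href.rate_nonneg
  rcases le_total t S.Tc with h | h
  · refine le_max_of_le_right ((hZ h).trans ?_)
    have h1 : z ≤ |z| := le_abs_self z
    have h2 : t * √(2 * v / μ₁) ≤ S.Tc * √(2 * v / μ₁) := by gcongr
    calc Real.exp (ℓ * t) * (z + t * √(2 * v / μ₁))
        ≤ Real.exp (ℓ * t) * (|z| + S.Tc * √(2 * v / μ₁)) := by gcongr
      _ ≤ _ := by
        have : 0 ≤ S.Tc := ht.trans h
        gcongr
  · refine le_max_of_le_left ?_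
    rw [← Zγ_of_le h]
    exact (norm_Zγ_lt_kc href ht hgap).le.trans (hk t ht)

/-- Performance of all solutions that start in an operating region, when the networks approximate
at the points of the solution in this region. The ultimate bound `B` is any bound for the signals at
the level `V ≤ ι₂ / ι₁ + 1`, and so it does not depend on the region. -/
theorem exists_performance (hplant : S.PlantAssumptions μ₁ μ₂)
    (href : S.RefAssumptions ℓ) (hgain : S.GainAssumptions κ Sabar Scbar) (Wa : Fin n → Vec la)
    (Wc : Vec lc) (εa ec : ℝ) {k B : ℝ} (hk : ∀ t, 0 ≤ t → S.kc t ≤ k)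
    (hB : ∀ t x, 0 ≤ t → 0 < S.gap t x.1 →
      S.V Wa Wc t x ≤ S.ι₂ Sabar Scbar Wa Wc εa ec / S.ι₁ μ₂ κ Scbar + 1 →
      ‖S.Z₁ t x.1‖ ≤ k → S.ApproxAt Wa Wc εa ec t x → S.SignalsLE t x B)
    {v : ℝ} (z : ℝ) (hv : S.ι₂ Sabar Scbar Wa Wc εa ec / S.ι₁ μ₂ κ Scbar < v) :
    ∃ Br Tr : ℝ, ∃ T' : ℝ → ℝ, ∀ (T : ℝ) (x : ℝ → State n la lc),
      S.IsSolutionOn (Ico 0 T) x → (0, x 0) ∈ S.region μ₁ ℓ Wa Wc v z →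
      (∀ t ∈ Ico 0 T, (t, x t) ∈ S.region μ₁ ℓ Wa Wc v z → S.ApproxAt Wa Wc εa ec t (x t)) →
      S.Performance (Ico 0 T) x
        (S.ι₂ Sabar Scbar Wa Wc εa ec / S.ι₁ μ₂ κ Scbar) B Br Tr T' := by
  set c := S.ι₂ Sabar Scbar Wa Wc εa ec / S.ι₁ μ₂ κ Scbar with hc
  have hβ := hgain.β_pos
  have hι := ι₁_pos hplant hgain
  obtain ⟨Br, hBr⟩ := exists_signalsLE hplant href hgain Wa Wc εa ec v
    (max k (Real.exp (ℓ * S.Tc) * (|z| + S.Tc * √(2 * v / μ₁))))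
  obtain ⟨T₁, hT₁⟩ := exists_forall_mul_exp_neg_le hι v one_pos
  choose! δ hδ0 hδ using fun (ε : ℝ) (hε : 0 < ε) => exists_radius_le S.β c k hε
  choose! T₂ hT₂ using fun (ε : ℝ) (hε : 0 < ε) => exists_forall_mul_exp_neg_le hι v (hδ0 ε hε)
  refine ⟨Br, max S.Tc T₁, fun ε => max S.Tc (T₂ ε), fun T x hx h₀ happ t ht => ?_⟩
  have hreg := mem_region_of_isRightSolution hplant href hgain hv hx h₀ happ
  have hV := V_le_of_isRightSolution hplant href hgain hx h₀.2.2.1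
    (fun s hs => (hreg s hs).2.1) (fun s hs => happ s hs (hreg s hs)) t ht
  have happt := happ t ht (hreg t ht)
  obtain ⟨-, hgap : 0 < S.gap t (x t).1, hVv : S.V Wa Wc t (x t) ≤ v, -⟩ := hreg t ht
  have hZγ := norm_Zγ_lt_kc href ht.1 hgap
  refine ⟨(hBr t (x t) ht.1 hgap hVv (norm_Z₁_le_of_mem_region href hk (hreg t ht)) happt).1,
    fun hTr => ?_, hZγ, fun hTc => ?_, fun ε hε hT' => ?_⟩
  · rw [Zγ_of_le ((le_max_left _ _).trans hTr)] at hZγ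
    exact hB t (x t) ht.1 hgap (by linarith [hT₁ t ((le_max_right _ _).trans hTr)])
      (hZγ.le.trans (hk t ht.1)) happt
  · rw [Zγ_of_le hTc] at hZγ
    exact ⟨hZγ, mem_admissible_of_norm_Z₁_lt hZγ⟩
  · have hV₁ : S.V₁ t (x t).1 ≤ c + δ ε :=
      (V₁_le_V hplant hgain.σc_pos Wa Wc t (x t)).trans
        (by linarith [hT₂ ε hε t ((le_max_right _ _).trans hT')])
    exact (norm_Z₁_le_radius href hβ ht.1 ((le_max_left _ _).trans hT') hgap hV₁).trans
      (hδ ε hε _ (href.kc_pos ht.1) (hk t ht.1))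

theorem ApproxOn.approxAt {D : Set (ℝ × State n la lc)} {Wa : Fin n → Vec la} {Wc : Vec lc}
    {εa ec t : ℝ} {x : State n la lc} (h : S.ApproxOn D Wa Wc εa ec) (hx : (t, x) ∈ D) :
    S.ApproxAt Wa Wc εa ec t x := h (t, x) hx

/-! ### Initial states and global existence -/

/-- At `t = 0` the shifting function vanishes, so that every initial state is inside the barrier. -/
theorem gap_zero_pos (href : S.RefAssumptions ℓ) (hTc : 0 < S.Tc) (q : Vec n) :
    0 < S.gap 0 q := by
  have h := pow_pos (href.kc_pos le_rfl) 2
  rwa [gap, Zγ, shift_zero hTc, zero_smul, norm_zero, zero_pow two_ne_zero, sub_zero]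

/-- Every bounded set of initial states is contained in the slice `t = 0` of a region. -/
theorem exists_mem_region (hplant : S.PlantAssumptions μ₁ μ₂) (href : S.RefAssumptions ℓ)
    (hgain : S.GainAssumptions κ Sabar Scbar) (Wa : Fin n → Vec la) (Wc : Vec lc) (r c : ℝ) :
    ∃ v z, c < v ∧ ∀ x : State n la lc, ‖x‖ ≤ r → (0, x) ∈ S.region μ₁ ℓ Wa Wc v z := by
  have hcont : Continuous (fun x : State n la lc => S.V Wa Wc 0 x) := by
    rw [continuous_iff_continuousAt]
    intro x
    exact ContinuousAt.comp (f := fun x : State n la lc => ((0 : ℝ), x))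
      (continuousAt_V hplant href hgain.β_pos Wa Wc (p := ((0 : ℝ), x)) le_rfl
        (gap_zero_pos href hgain.Tc_pos x.1)) (by fun_prop)
  obtain ⟨b, hb⟩ := (isCompact_closedBall (0 : State n la lc) r).exists_bound_of_continuousOn
    hcont.continuousOn
  refine ⟨max (c + 1) b, r + ‖S.qd 0‖, lt_max_of_lt_left (by linarith), fun x hx =>
    ⟨le_rfl, gap_zero_pos href hgain.Tc_pos x.1, ?_, fun _ => ?_⟩⟩
  · exact le_max_of_le_right ((le_abs_self _).trans (hb x (mem_closedBall_zero_iff.2 hx)))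
  · simp only [mul_zero, Real.exp_zero, zero_mul, add_zero, one_mul]
    exact norm_sub_le_of_le ((norm_fst_le x).trans hx) le_rfl

/-- In an operating region the gap is bounded below, and the bound passes to limits. -/
theorem gap_pos_of_tendsto (hplant : S.PlantAssumptions μ₁ μ₂) (href : S.RefAssumptions ℓ)
    (hgain : S.GainAssumptions κ Sabar Scbar) {Wa : Fin n → Vec la} {Wc : Vec lc} {v z T : ℝ}
    (hT : 0 < T) {x : ℝ → State n la lc} {e : State n la lc}
    (hr : ∀ t ∈ Ico 0 T, (t, x t) ∈ S.region μ₁ ℓ Wa Wc v z) (he : Tendsto x (𝓝[<] T) (𝓝 e)) :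
    0 < S.gap T e.1 := by
  obtain ⟨b, hb, hbk⟩ := href.kc_lower
  have hpair : Tendsto (fun t => (t, x t)) (𝓝[<] T) (𝓝 (T, e)) :=
    Tendsto.prodMk_nhds (tendsto_id.mono_left nhdsWithin_le_nhds) he
  have hlim := ((continuous_gap href).tendsto (T, e)).comp hpair
  refine lt_of_lt_of_le (by positivity : 0 < b ^ 2 * Real.exp (-(2 * S.β * v)))
    (ge_of_tendsto hlim ?_)
  filter_upwards [Ico_mem_nhdsLT hT] with t ht
  have h1 := gap_ge_of_V₁_le href hgain.β_pos ht.1 (hr t ht).2.1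
    ((V₁_le_V hplant hgain.σc_pos Wa Wc t (x t)).trans (hr t ht).2.2.1)
  have h2 := hbk t ht.1
  refine le_trans ?_ h1
  gcongr

/-- If the networks approximate on an operating region, then there is a global solution from every
initial state in it: the region confines solutions, and there they have bounded velocity. -/
theorem exists_global_solution (hplant : S.PlantAssumptions μ₁ μ₂) (href : S.RefAssumptions ℓ)
    (hgain : S.GainAssumptions κ Sabar Scbar) {Wa : Fin n → Vec la} {Wc : Vec lc} {εa ec v z : ℝ}
    (hv : S.ι₂ Sabar Scbar Wa Wc εa ec / S.ι₁ μ₂ κ Scbar < v)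
    (happ : S.ApproxOn (S.region μ₁ ℓ Wa Wc v z) Wa Wc εa ec) {x₀ : State n la lc}
    (h₀ : (0, x₀) ∈ S.region μ₁ ℓ Wa Wc v z) :
    ∃ x, S.IsSolutionOn (Ici 0) x ∧ x 0 = x₀ := by
  have hβ := hgain.β_pos
  have hreg : ∀ T x, IsRightSolution S.field (Ico 0 T) x → x 0 = x₀ →
      ∀ t ∈ Ico 0 T, (t, x t) ∈ S.region μ₁ ℓ Wa Wc v z := fun T x hx hx0 =>
    mem_region_of_isRightSolution hplant href hgain hv hx (by rwa [hx0]) fun t _ hr => happ.approxAt hr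
  refine exists_isRightSolution_Ici (rightRegularAt_field hplant href hβ le_rfl h₀.2.1) ?_ ?_
  · intro T x y hx hy hx0 hy0
    exact hx.eqOn (fun t ht => rightRegularAt_field hplant href hβ ht.1 (hreg T x hx hx0 t ht).2.1)
      hy (by rw [hx0, hy0])
  · intro T x hT hx hx0
    obtain ⟨k, hk⟩ := href.kc_upper
    obtain ⟨B, hB⟩ := exists_signalsLE hplant href hgain Wa Wc εa ec v
      (max k (Real.exp (ℓ * S.Tc) * (|z| + S.Tc * √(2 * v / μ₁))))
    have hr := hreg T x hx hx0
    obtain ⟨e, he⟩ := hx.exists_tendsto hT fun t ht =>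
      (hB t (x t) ht.1 (hr t ht).2.1 (hr t ht).2.2.1 (norm_Z₁_le_of_mem_region href hk (hr t ht))
        (happ.approxAt (hr t ht))).2
    exact ⟨e, he, rightRegularAt_field hplant href hβ hT.le
      (gap_pos_of_tendsto hplant href hgain hT hr he)⟩

end ArmControl

theorem theorem1 {n la lc : ℕ} (hn : 0 < n) (S : ArmControl n la lc)
    (μ₁ μ₂ ℓ κ Sabar Scbar : ℝ)
    (hplant : S.PlantAssumptions μ₁ μ₂) (href : S.RefAssumptions ℓ)
    (hgain : S.GainAssumptions κ Sabar Scbar)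
    (Wa : Fin n → Vec la) (Wc : Vec lc) (εa ec : ℝ) :
    0 < S.ι₁ μ₂ κ Scbar ∧ 0 < S.ι₂ Sabar Scbar Wa Wc εa ec ∧
    -- the ultimate bound `B` does not depend on the size of the initial state
    (∃ B : ℝ,
      -- every solution performs as claimed for as long as it stays where the networks approximate
      (∀ r : ℝ, ∃ Br Tr : ℝ, ∃ T' : ℝ → ℝ,
        ∀ D : Set (ℝ × State n la lc), S.ApproxOn D Wa Wc εa ec →
        ∀ (T : ℝ) (x : ℝ → State n la lc), S.IsSolutionOn (Set.Ico 0 T) x → ‖x 0‖ ≤ r →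
          (∀ t ∈ Set.Ico 0 T, (t, x t) ∈ D) →
          S.Performance (Set.Ico 0 T) x
            (S.ι₂ Sabar Scbar Wa Wc εa ec / S.ι₁ μ₂ κ Scbar) B Br Tr T') ∧
      -- if the networks approximate on an operating region, then from each initial state in it
      -- there is exactly one solution; it exists for all times, stays in the region and performs
      -- as claimed
      (∀ v z : ℝ, S.ι₂ Sabar Scbar Wa Wc εa ec / S.ι₁ μ₂ κ Scbar < v →
        S.ApproxOn (S.region μ₁ ℓ Wa Wc v z) Wa Wc εa ec →
        ∃ Br Tr : ℝ, ∃ T' : ℝ → ℝ,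
        ∀ x₀ : State n la lc, (0, x₀) ∈ S.region μ₁ ℓ Wa Wc v z →
          ∃ x : ℝ → State n la lc, S.IsSolutionOn (Set.Ici 0) x ∧ x 0 = x₀ ∧
            (∀ (T : ℝ) (y : ℝ → State n la lc), S.IsSolutionOn (Set.Ico 0 T) y → y 0 = x₀ →
              Set.EqOn y x (Set.Ico 0 T)) ∧
            (∀ t, 0 ≤ t → (t, x t) ∈ S.region μ₁ ℓ Wa Wc v z) ∧
            S.Performance (Set.Ici 0) x
              (S.ι₂ Sabar Scbar Wa Wc εa ec / S.ι₁ μ₂ κ Scbar) B Br Tr T')) := by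
  obtain ⟨k, hk⟩ := href.kc_upper
  obtain ⟨B, hB⟩ := S.exists_signalsLE hplant href hgain Wa Wc εa ec
    (S.ι₂ Sabar Scbar Wa Wc εa ec / S.ι₁ μ₂ κ Scbar + 1) k
  have hB' := fun t x h₁ h₂ h₃ h₄ h₅ => (hB t x h₁ h₂ h₃ h₄ h₅).1
  refine ⟨ArmControl.ι₁_pos hplant hgain, ArmControl.ι₂_pos hgain Wa Wc εa ec, B, fun r => ?_,
    fun v z hv happ => ?_⟩
  · obtain ⟨v, z, hv, hmem⟩ := ArmControl.exists_mem_region hplant href hgain Wa Wc r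
      (S.ι₂ Sabar Scbar Wa Wc εa ec / S.ι₁ μ₂ κ Scbar)
    obtain ⟨Br, Tr, T', h⟩ :=
      ArmControl.exists_performance hplant href hgain Wa Wc εa ec hk hB' z hv
    exact ⟨Br, Tr, T', fun D hD T x hx hr hxD =>
      h T x hx (hmem _ hr) fun t ht _ => hD.approxAt (hxD t ht)⟩
  · obtain ⟨Br, Tr, T', h⟩ :=
      ArmControl.exists_performance hplant href hgain Wa Wc εa ec hk hB' z hv
    refine ⟨Br, Tr, T', fun x₀ h₀ => ?_⟩
    obtain ⟨x, hx, rfl⟩ := ArmControl.exists_global_solution hplant href hgain hv happ h₀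
    have hx' : ∀ T, IsRightSolution S.field (Set.Ico 0 T) x :=
      fun T => IsRightSolution.mono hx Set.Ico_subset_Ici_self
    have hreg : ∀ t, 0 ≤ t → (t, x t) ∈ S.region μ₁ ℓ Wa Wc v z := fun t ht =>
      ArmControl.mem_region_of_isRightSolution hplant href hgain hv (hx' (t + 1)) h₀
        (fun s _ hs => happ.approxAt hs) t ⟨ht, lt_add_one t⟩
    refine ⟨x, hx, rfl, fun T y hy hy0 => ?_, hreg, fun t ht => ?_⟩
    · exact ((hx' T).eqOn (fun t ht => ArmControl.rightRegularAt_field hplant href hgain.β_pos ht.1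
        (hreg t ht.1).2.1) hy hy0.symm).symm
    · exact h (t + 1) x (hx' _) h₀ (fun s _ hs => happ.approxAt hs) t ⟨ht, lt_add_one t⟩
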